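/- Let $\rho>0$, let $m\ge 0$ and $0\le n_0\le m$ be integers, and let $\theta\in\mathbb C$ with $\operatorname{Re}\theta>0$. All powers below are principal. For $n\ge0$ put $$F_n(\theta)=\frac1{2\pi i}\int_{C_0}\frac{e^{\rho z}}{z^{n+1}(1-z)^{\theta}}\,dz,\qquad G_n(\theta)=\frac1{2\pi i}\int_{C_1}\frac{e^{\rho z}}{z^{n+1}(z-1)^{\theta}}\,dz,$$ where $C_0$ is a counterclockwise circle $|z|=r$ with $0<r<1$, and $C_1$ goes from $-\infty-i\varepsilon$ to $-\infty+i\varepsilon$ ($\varepsilon>0$), encircling $z=1$ counterclockwise (along straight lines through $R-i\varepsilon$ and $R+i\varepsilon$ with $R>1$). For $\eta>0$ let $N(t)$ be the queue length of the Erlang A model $M/M/m+M$ with arrival rate $\rho$, service rate $1$, $m$ servers and abandonment rate $\eta$, that is, the birth-death process on $\{0,1,2,\dots\}$ with birth rates $\rho$ and death rates $n$ for $n\le m$ and $m+(n-m)\eta$ for $n>m$. The queue length of the Erlang loss model $M/M/m/m$ is the birth-death process on $\{0,\dots,m\}$ with birth rates $\rho$ for $n<m$ and death rates $n$. In either model let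 $p_n(t)=\mathbb P[N(t)=n\mid N(0)=n_0]$ and $\widehat P_n(\theta)=\int_0^\infty e^{-\theta t}p_n(t)\,dt$; these integrals converge absolutely for $0\le n\le m$. As $\eta\to\infty$, for every $0\le n\le m$ the transform $\widehat P_n(\theta)$ in the Erlang A model converges to a limit. This limit equals the transform $\widehat P_n(\theta)$ in the Erlang loss model, and it is given by $$\frac{n_0!\,\Gamma(\theta)e^{-\rho}}{\rho^{n_0+\theta}}\,F_{n_0}(\theta)\,[G_n(\theta)+\omega F_n(\theta)],\qquad n_0\le n\le m,$$ $$\frac{n_0!\,\Gamma(\theta)e^{-\rho}}{\rho^{n_0+\theta}}\,F_{n}(\theta)\,[G_{n_0}(\theta)+\omega F_{n_0}(\theta)],\qquad 0\le n\le n_0,$$ where $$\omega=\frac{(m+1)G_{m+1}(\theta)-\rho G_m(\theta)}{\rho F_m(\theta)-(m+1)F_{m+1}(\theta)}.$$ In particular the limit for $n=m$, which is the Laplace transform of the blocking probability $p_m(t)$ of the loss model, equals $$\frac{n_0!}{m!}\,\rho^{m-n_0}\,\frac{F_{n_0}(\theta)}{(m+1)F_{m+1}(\theta)-\rho F_m(\theta)}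 =\frac{\sum_{\ell=0}^{n_0}\binom{n_0}{\ell}\rho^{-\ell}\,\Gamma(\theta+\ell)}{\sum_{\ell=0}^{m}\binom{m}{\ell}\rho^{-\ell}\,\Gamma(\theta+\ell+1)},$$ and if $n_0=0$ it agrees with Jagerman's formula $$\frac{\Gamma(\theta)}{\int_0^\infty e^{-\xi}\xi^{\theta}\left(1+\frac{\xi}{\rho}\right)^m d\xi}.$$ All denominators here are non-zero. -/

import Mathlib

open MeasureTheory ProbabilityTheory Filter Topology Set

noncomputable section

namespace ErlangQueue

/-! ### Continuous-time Markov chains with prescribed transition rates -/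

/-- `P t i j` (for `t ≥ 0`) is a stochastic transition function on `S` whose transition rates are
`q i j`, that is `P t i j = δ i j + q i j * t + o(t)` as `t ↓ 0`. -/
structure IsTransitionFunction {S : Type*} [DecidableEq S] (q : S → S → ℝ)
    (P : ℝ → S → S → ℝ) : Prop where
  nonneg : ∀ t, 0 ≤ t → ∀ i j, 0 ≤ P t i j
  hasSum_one : ∀ t, 0 ≤ t → ∀ i, HasSum (fun j => P t i j) 1
  zero : ∀ i j, P 0 i j = if i = j then 1 else 0
  chapman_kolmogorov : ∀ s t, 0 ≤ s → 0 ≤ t → ∀ i j,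
    HasSum (fun k => P s i k * P t k j) (P (s + t) i j)
  rates : ∀ i j, HasDerivWithinAt (fun t => P t i j) (q i j) (Ici 0) 0

/-- The process `(N t)`, `t ≥ 0`, is a time-homogeneous Markov chain with transition rates `q`
(with an arbitrary initial law). The values of `N` at negative times play no role. -/
def IsMarkovChain {S Ω : Type*} [DecidableEq S] [MeasurableSpace S] [MeasurableSpace Ω]
    (q : S → S → ℝ) (μ : Measure Ω) (N : ℝ → Ω → S) : Prop :=
  (∀ t, 0 ≤ t → Measurable (N t)) ∧
  ∃ P : ℝ → S → S → ℝ, IsTransitionFunction q P ∧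
    ∀ (k : ℕ) (t : Fin (k + 1) → ℝ) (s : Fin (k + 1) → S), 0 ≤ t 0 → Monotone t →
      μ.real {ω | ∀ i, N (t i) ω = s i} =
        μ.real {ω | N (t 0) ω = s 0} *
          ∏ i : Fin k, P (t i.succ - t i.castSucc) (s i.castSucc) (s i.succ)

/-- The transition rates of the birth-death process with birth rates `b` and death rates `d`. -/
def birthDeathRate (b d : ℕ → ℝ) (i j : ℕ) : ℝ :=
  if j = i + 1 then b i
  else if i = j + 1 then d i
  else if i = j then -(b i + d i)
  else 0

/-- The rates of the queue length of the Erlang A model `M/M/m+M`: arrival rate `ρ`, service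
rate `1`, `m` servers, abandonment rate `η` of each waiting customer. -/
def erlangARate (ρ : ℝ) (m : ℕ) (η : ℝ) : ℕ → ℕ → ℝ :=
  birthDeathRate (fun _ => ρ)
    (fun n => if n ≤ m then (n : ℝ) else (m : ℝ) + ((n : ℝ) - (m : ℝ)) * η)

/-- The rates of the queue length of the Erlang loss model `M/M/m/m`, with state space
`{0, …, m}`: arrival rate `ρ`, service rate `1`, arrivals that find `m` customers are lost. -/
def erlangLossRate (ρ : ℝ) (m : ℕ) (i j : Fin (m + 1)) : ℝ :=
  birthDeathRate (fun n => if n < m then ρ else 0) (fun n => (n : ℝ)) i j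

/-- `p_n(t) = μ[N(t) = n | N(0) = n₀]`. -/
def transientProb {S Ω : Type*} [MeasurableSpace Ω] (μ : Measure Ω) (N : ℝ → Ω → S)
    (n₀ n : S) (t : ℝ) : ℝ :=
  (μ[|N 0 ⁻¹' {n₀}]).real (N t ⁻¹' {n})

/-! ### Laplace transforms -/

/-- The integral defining the Laplace transform of `f` at `θ` converges absolutely. -/
def LaplaceIntegrable (f : ℝ → ℝ) (θ : ℂ) : Prop :=
  IntegrableOn (fun t : ℝ => Complex.exp (-θ * t) * (f t : ℂ)) (Ioi 0)

/-- The Laplace transform of `f` at `θ`. -/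
def laplaceTransform (f : ℝ → ℝ) (θ : ℂ) : ℂ :=
  ∫ t in Ioi (0 : ℝ), Complex.exp (-θ * t) * (f t : ℂ)

/-! ### The contour integrals -/

/-- `F_n(θ)`, the integral over the counterclockwise circle of radius `r` about `0`
(for `0 < r < 1`), with the principal branch of `(1 - z) ^ θ`. -/
def F (r ρ : ℝ) (n : ℕ) (θ : ℂ) : ℂ :=
  (2 * (Real.pi : ℂ) * Complex.I)⁻¹ *
    ∮ z in C(0, r), Complex.exp ((ρ : ℂ) * z) / (z ^ (n + 1) * (1 - z) ^ θ)

/-- The integrand of `G_n(θ)`, with the principal branch of `(z - 1) ^ θ`. -/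
def integrandG (ρ : ℝ) (n : ℕ) (θ z : ℂ) : ℂ :=
  Complex.exp ((ρ : ℂ) * z) / (z ^ (n + 1) * (z - 1) ^ θ)

/-- `∫ g(z) dz` over the contour that goes from `-∞ - iε` to `R - iε`, then up to `R + iε`, then
back to `-∞ + iε`, along straight lines. For `ε > 0` and `R > 1` it encircles `z = 1`
counterclockwise and avoids the half-line `(-∞, 1]`. -/
def hankelIntegral (ε R : ℝ) (g : ℂ → ℂ) : ℂ :=
  (∫ x in Iic R, g ((x : ℂ) - (ε : ℂ) * Complex.I)) +
    Complex.I * (∫ y in (-ε)..ε, g ((R : ℂ) + (y : ℂ) * Complex.I)) -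
    ∫ x in Iic R, g ((x : ℂ) + (ε : ℂ) * Complex.I)

/-- `G_n(θ)`. -/
def G (ε R ρ : ℝ) (n : ℕ) (θ : ℂ) : ℂ :=
  (2 * (Real.pi : ℂ) * Complex.I)⁻¹ * hankelIntegral ε R (integrandG ρ n θ)

/-- `ω = ((m+1) G_{m+1} - ρ G_m) / (ρ F_m - (m+1) F_{m+1})`. -/
def omega (r ε R ρ : ℝ) (m : ℕ) (θ : ℂ) : ℂ :=
  (((m : ℂ) + 1) * G ε R ρ (m + 1) θ - (ρ : ℂ) * G ε R ρ m θ) /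
    ((ρ : ℂ) * F r ρ m θ - ((m : ℂ) + 1) * F r ρ (m + 1) θ)

/-- `∑_{ℓ=0}^{n} (n choose ℓ) ρ^{-ℓ} Γ(s + ℓ)`. -/
def gammaSum (ρ : ℝ) (n : ℕ) (s : ℂ) : ℂ :=
  ∑ l ∈ Finset.range (n + 1), (n.choose l : ℂ) * ((ρ : ℂ) ^ l)⁻¹ * Complex.Gamma (s + (l : ℂ))

/-- Jagerman's integral `∫_0^∞ e^{-ξ} ξ^θ (1 + ξ/ρ)^m dξ`. -/
def jagermanIntegral (ρ : ℝ) (m : ℕ) (θ : ℂ) : ℂ :=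
  ∫ ξ in Ioi (0 : ℝ), Complex.exp (-(ξ : ℂ)) * (ξ : ℂ) ^ θ * (1 + (ξ : ℂ) / (ρ : ℂ)) ^ m

end ErlangQueue

end

open ErlangQueue

/-! Fix the target state `j ≤ m` and let the initial state `i` vary. By Kolmogorov's backward
equation the transforms `u i` satisfy, for `i ≤ m`, `θ u_i - δ_ij = ρ (u_{i+1} - u_i) + i (u_{i-1} -
u_i)`. These rows are the same in both models and do not involve `η`; the models differ only in the
jump `u_{m+1} - u_m`. In the loss model the jump is zero once `u` is extended by `u_{m+1} = u_m`. In
the Erlang A model row `m + 1` has death rate `m + η`, and all transforms are bounded by `1 / Re θ`,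
so the jump is `O(1/η)`. Only the backward equation is used: its rows are finite, so it follows from
the rates at time `0` and Chapman-Kolmogorov.

It remains to solve the rows with a prescribed jump. Integration by parts in the contour integrals
shows that `F_n` and `G_n` satisfy one three-term recurrence, and the weight `n!/ρ^n` turns it into
the homogeneous backward equation (`backward_of_recurrence`). The `F` solution is the one that fits
row `0`; `ω` makes the jump of the weighted `G + ωF` at `m` vanish. The two give a Green function,
normalised by their Wronskian, which Hankel's integral for `1/Γ` evaluates
(`Gamma_mul_hankelIntegral`, `wronskian_zero`). Any `u` as above is the Green function plus its jump
times a fixed multiple of the `F` solution (`IsSolutionPair.eq_green_add`), so a vanishing jump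
gives the limit and the loss model at once.

The multiple is finite because `(m+1) F_{m+1} - ρ F_m ≠ 0`, which an energy estimate provides
(`re_pos_F`). The closed forms at `n = m` come from the Wronskian at `m` and from writing `F_n` as a
finite sum of Gamma values. -/

noncomputable section

namespace ErlangQueue

/-! ### The integrals `F_n` -/

/-- The integrand of `F_n(θ)`. -/
def integrandF (ρ : ℝ) (n : ℕ) (θ z : ℂ) : ℂ :=
  Complex.exp ((ρ : ℂ) * z) / (z ^ (n + 1) * (1 - z) ^ θ)

theorem F_eq_circleIntegral (r ρ : ℝ) (n : ℕ) (θ : ℂ) :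
    F r ρ n θ = (2 * (Real.pi : ℂ) * Complex.I)⁻¹ * ∮ z in C(0, r), integrandF ρ n θ z := rfl

theorem one_sub_mem_slitPlane {z : ℂ} (hz : ‖z‖ < 1) : 1 - z ∈ Complex.slitPlane := by
  left
  have := Complex.abs_re_le_norm z
  have := le_abs_self z.re
  simp only [Complex.sub_re, Complex.one_re]
  linarith

theorem hasDerivAt_integrandF (ρ : ℝ) (n : ℕ) (θ : ℂ) {z : ℂ} (hz₀ : z ≠ 0) (hz : ‖z‖ < 1) :
    HasDerivAt (integrandF ρ n θ)
      ((ρ : ℂ) * integrandF ρ n θ z + θ * integrandF ρ n (θ + 1) z -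
        ((n : ℂ) + 1) * integrandF ρ (n + 1) θ z) z := by
  have hs := one_sub_mem_slitPlane hz
  have h1 : (1 - z) ≠ 0 := Complex.slitPlane_ne_zero hs
  have hp : (1 - z) ^ θ ≠ 0 := by simp [Complex.cpow_eq_zero_iff, h1]
  have hd1 : HasDerivAt (fun z : ℂ => Complex.exp ((ρ : ℂ) * z))
      (Complex.exp ((ρ : ℂ) * z) * (ρ * 1)) z := ((hasDerivAt_id z).const_mul (ρ : ℂ)).cexp
  have hd2 : HasDerivAt (fun z : ℂ => z ^ (n + 1)) (((n + 1 : ℕ) : ℂ) * z ^ n) z := by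
    simpa using hasDerivAt_pow (n + 1) z
  have hd3 : HasDerivAt (fun z : ℂ => (1 - z) ^ θ) (θ * (1 - z) ^ (θ - 1) * (-1)) z :=
    ((hasDerivAt_id z).const_sub 1).cpow_const hs
  have hd := hd1.div (hd2.mul hd3) (mul_ne_zero (pow_ne_zero _ hz₀) hp)
  refine hd.congr_deriv ?_
  simp only [integrandF, Pi.mul_apply]
  rw [Complex.cpow_add _ _ h1, Complex.cpow_sub _ _ h1, Complex.cpow_one]
  push_cast
  field_simp
  ring

theorem norm_lt_one_of_mem_sphere {r : ℝ} (hr₁ : r < 1) {z : ℂ} (hz : z ∈ Metric.sphere (0 : ℂ) r) :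
    ‖z‖ < 1 := by
  rw [mem_sphere_zero_iff_norm] at hz
  rwa [hz]

theorem ne_zero_of_mem_sphere {r : ℝ} (hr₀ : 0 < r) {z : ℂ}
    (hz : z ∈ Metric.sphere (0 : ℂ) r) : z ≠ 0 := by
  rw [mem_sphere_zero_iff_norm] at hz
  rw [← norm_pos_iff, hz]
  exact hr₀

theorem circleIntegrable_integrandF {r : ℝ} (hr₀ : 0 < r) (hr₁ : r < 1) (ρ : ℝ) (n : ℕ) (θ : ℂ) :
    CircleIntegrable (integrandF ρ n θ) 0 r :=
  ContinuousOn.circleIntegrable hr₀.le fun _ hz =>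
    (hasDerivAt_integrandF ρ n θ (ne_zero_of_mem_sphere hr₀ hz)
      (norm_lt_one_of_mem_sphere hr₁ hz)).continuousAt.continuousWithinAt

/-- Integration by parts: the derivative of the integrand has zero integral over a closed circle. -/
theorem F_succ_eq {r : ℝ} (hr₀ : 0 < r) (hr₁ : r < 1) (ρ : ℝ) (n : ℕ) (θ : ℂ) :
    ((n : ℂ) + 1) * F r ρ (n + 1) θ = ρ * F r ρ n θ + θ * F r ρ n (θ + 1) := by
  have h := circleIntegral.integral_eq_zero_of_hasDerivWithinAt (c := (0 : ℂ)) hr₀.le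
    fun z hz => (hasDerivAt_integrandF ρ n θ (ne_zero_of_mem_sphere hr₀ hz)
      (norm_lt_one_of_mem_sphere hr₁ hz)).hasDerivWithinAt
  have hi := circleIntegrable_integrandF hr₀ hr₁ ρ
  have hc : ∀ (c : ℂ) n θ, CircleIntegrable (fun z => c * integrandF ρ n θ z) 0 r :=
    fun c n θ => (hi n θ).const_fun_smul (a := c)
  rw [circleIntegral.integral_sub (f := fun z => (ρ : ℂ) * integrandF ρ n θ z +
      θ * integrandF ρ n (θ + 1) z) ((hc _ _ _).add (hc _ _ _)) (hc _ _ _),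
    circleIntegral.integral_add (hc _ _ _) (hc _ _ _), circleIntegral.integral_const_mul,
    circleIntegral.integral_const_mul, circleIntegral.integral_const_mul] at h
  simp only [F_eq_circleIntegral]
  linear_combination (-(2 * (Real.pi : ℂ) * Complex.I)⁻¹) * h

theorem F_add_one_sub {r : ℝ} (hr₀ : 0 < r) (hr₁ : r < 1) (ρ : ℝ) (n : ℕ) (θ : ℂ) :
    F r ρ (n + 1) (θ + 1) - F r ρ n (θ + 1) = F r ρ (n + 1) θ := by
  simp only [F_eq_circleIntegral]
  rw [← mul_sub, ← circleIntegral.integral_sub (circleIntegrable_integrandF hr₀ hr₁ ρ _ _)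
    (circleIntegrable_integrandF hr₀ hr₁ ρ _ _)]
  congr 1
  refine circleIntegral.integral_congr hr₀.le fun z hz => ?_
  have hz₀ := ne_zero_of_mem_sphere hr₀ hz
  have h1 : (1 - z) ≠ 0 :=
    Complex.slitPlane_ne_zero (one_sub_mem_slitPlane (norm_lt_one_of_mem_sphere hr₁ hz))
  have hp : (1 - z) ^ θ ≠ 0 := by simp [Complex.cpow_eq_zero_iff, h1]
  simp only [integrandF]
  rw [Complex.cpow_add _ _ h1, Complex.cpow_one]
  field_simp
  ring

theorem F_zero {r : ℝ} (hr₀ : 0 < r) (hr₁ : r < 1) (ρ : ℝ) (θ : ℂ) : F r ρ 0 θ = 1 := by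
  have hd : DifferentiableOn ℂ (fun z : ℂ => Complex.exp ((ρ : ℂ) * z) / (1 - z) ^ θ)
      (Metric.closedBall 0 r) := by
    intro z hz
    have hz1 : ‖z‖ < 1 := (mem_closedBall_zero_iff.1 hz).trans_lt hr₁
    have hs := one_sub_mem_slitPlane hz1
    have h1 : (1 - z) ≠ 0 := Complex.slitPlane_ne_zero hs
    have hp : (1 - z) ^ θ ≠ 0 := by simp [Complex.cpow_eq_zero_iff, h1]
    have hd1 : DifferentiableAt ℂ (fun z : ℂ => Complex.exp ((ρ : ℂ) * z)) z := by fun_prop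
    exact (hd1.div (((hasDerivAt_id z).const_sub 1).cpow_const (c := θ) hs).differentiableAt
      hp).differentiableWithinAt
  have h := (hd.diffContOnCl_ball subset_rfl).circleIntegral_sub_inv_smul
    (w := 0) (by simpa using hr₀)
  rw [F_eq_circleIntegral]
  have h2 : (∮ z in C(0, r), integrandF ρ 0 θ z) = 2 * Real.pi * Complex.I := by
    rw [show (2 * Real.pi * Complex.I : ℂ) = (2 * ↑Real.pi * Complex.I) •
      (Complex.exp ((ρ : ℂ) * 0) / (1 - 0) ^ θ) by simp, ← h]
    refine circleIntegral.integral_congr hr₀.le fun z hz => ?_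
    simp only [integrandF, sub_zero, smul_eq_mul, zero_add, pow_one]
    rw [div_mul_eq_div_div_swap, div_eq_inv_mul]
  rw [h2, inv_mul_cancel₀ Complex.two_pi_I_ne_zero]

theorem F_one {r : ℝ} (hr₀ : 0 < r) (hr₁ : r < 1) (ρ : ℝ) (θ : ℂ) : F r ρ 1 θ = ρ + θ := by
  have := F_succ_eq hr₀ hr₁ ρ 0 θ
  simpa [F_zero hr₀ hr₁] using this

/-- The values at `θ + 1` are eliminated between two consecutive integrations by parts. -/
theorem F_recurrence {r : ℝ} (hr₀ : 0 < r) (hr₁ : r < 1) (ρ : ℝ) (n : ℕ) (θ : ℂ) :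
    ((n : ℂ) + 2) * F r ρ (n + 2) θ =
      (ρ + n + 1 + θ) * F r ρ (n + 1) θ - ρ * F r ρ n θ := by
  have h1 := F_succ_eq hr₀ hr₁ ρ n θ
  have h2 := F_succ_eq hr₀ hr₁ ρ (n + 1) θ
  have h3 := F_add_one_sub hr₀ hr₁ ρ n θ
  push_cast at h2
  linear_combination h2 - h1 + θ * h3

/-! ### Closed forms by Gamma sums, and non-vanishing of the denominators -/

theorem gammaSum_succ {ρ : ℝ} (n : ℕ) (s : ℂ) :
    gammaSum ρ (n + 1) s = gammaSum ρ n s + (ρ : ℂ)⁻¹ * gammaSum ρ n (s + 1) := by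
  simp only [gammaSum]
  rw [Finset.sum_range_succ' _ (n + 1), Finset.sum_range_succ' (fun l => (n.choose l : ℂ) * _ * _) n,
    Finset.mul_sum]
  have h : ∀ l : ℕ, ((n + 1).choose (l + 1) : ℂ) * ((ρ : ℂ) ^ (l + 1))⁻¹ *
      Complex.Gamma (s + ((l + 1 : ℕ) : ℂ)) =
      (n.choose (l + 1) : ℂ) * ((ρ : ℂ) ^ (l + 1))⁻¹ * Complex.Gamma (s + ((l + 1 : ℕ) : ℂ)) +
      (ρ : ℂ)⁻¹ * ((n.choose l : ℂ) * ((ρ : ℂ) ^ l)⁻¹ * Complex.Gamma (s + 1 + (l : ℂ))) := by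
    intro l
    rw [Nat.choose_succ_succ]
    push_cast
    rw [show s + 1 + (l : ℂ) = s + (l + 1) by ring, pow_succ, mul_inv]
    ring
  simp only [h, Finset.sum_add_distrib]
  rw [Finset.sum_range_succ (fun l => (n.choose (l + 1) : ℂ) * _ * _) n]
  simp
  ring

/-- Integration by parts for `F` matches Pascal's rule for `gammaSum`. Both shift `θ` by one, hence
the induction over all `θ`. -/
theorem F_eq_gammaSum {r : ℝ} (hr₀ : 0 < r) (hr₁ : r < 1) {ρ : ℝ} (hρ : ρ ≠ 0) (n : ℕ) {θ : ℂ}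
    (hθ : 0 < θ.re) :
    F r ρ n θ = (ρ : ℂ) ^ n / (n.factorial * Complex.Gamma θ) * gammaSum ρ n θ := by
  induction n generalizing θ with
  | zero =>
    have := Complex.Gamma_ne_zero_of_re_pos hθ
    simp [F_zero hr₀ hr₁, gammaSum, this]
  | succ n ih =>
    have hG := Complex.Gamma_ne_zero_of_re_pos hθ
    have hθ0 : θ ≠ 0 := by rintro rfl; simp at hθ
    have h := F_succ_eq hr₀ hr₁ ρ n θ
    rw [ih hθ, ih (θ := θ + 1) (by simp; linarith), Complex.Gamma_add_one _ hθ0] at h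
    have hn : ((n : ℂ) + 1) ≠ 0 := by exact_mod_cast n.succ_ne_zero
    have hf : (n.factorial : ℂ) ≠ 0 := by exact_mod_cast n.factorial_ne_zero
    have hρ' : (ρ : ℂ) ≠ 0 := by exact_mod_cast hρ
    rw [gammaSum_succ, ← mul_right_inj' hn, h, Nat.factorial_succ]
    push_cast
    field_simp
    ring

/-- A discrete energy estimate, stronger than non-vanishing so that it can be propagated. With `u_n
= (n+1) F_{n+1} - ρ F_n`, the recurrence reads `u_{n+1} = u_n + θ F_{n+1}`, while `(n+1) F_{n+1} =
u_n + ρ F_n`. Pairing with the conjugate of `F_{n+1}` leaves `|u_n|²`, the previous energy and `Re θ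
|F_{n+1}|²`, all with nonnegative coefficients. -/
theorem re_pos_F {r : ℝ} (hr₀ : 0 < r) (hr₁ : r < 1) {ρ : ℝ} (hρ : 0 < ρ) (n : ℕ) {θ : ℂ}
    (hθ : 0 < θ.re) :
    0 < ((((n : ℂ) + 1) * F r ρ (n + 1) θ - ρ * F r ρ n θ) *
      (starRingEnd ℂ) (F r ρ n θ)).re := by
  induction n with
  | zero =>
    simp [F_zero hr₀ hr₁, F_one hr₀ hr₁, hθ]
  | succ n ih =>
    have hrec := F_recurrence hr₀ hr₁ ρ n θ
    set u := ((n : ℂ) + 1) * F r ρ (n + 1) θ - ρ * F r ρ n θ with hu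
    set y := F r ρ n θ
    set y' := F r ρ (n + 1) θ
    have h1 : (((n + 1 : ℕ) : ℂ) + 1) * F r ρ (n + 1 + 1) θ - ρ * y' = u + θ * y' := by
      push_cast
      linear_combination hrec
    have hu0 : u ≠ 0 := by
      intro h0
      rw [h0] at ih
      simp at ih
    have hy : y' = ((n : ℂ) + 1)⁻¹ * (u + ρ * y) := by
      have hn : ((n : ℂ) + 1) ≠ 0 := by exact_mod_cast n.succ_ne_zero
      rw [hu]
      field_simp
      ring
    have h2 : (u * (starRingEnd ℂ) y').re =
        ((n : ℝ) + 1)⁻¹ * (Complex.normSq u + ρ * (u * (starRingEnd ℂ) y).re) := by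
      have : u * (starRingEnd ℂ) y' = (((n : ℝ) + 1)⁻¹ : ℝ) *
          ((Complex.normSq u : ℝ) + ρ * (u * (starRingEnd ℂ) y)) := by
        rw [hy, ← Complex.mul_conj u]
        simp
        ring
      rw [this, Complex.re_ofReal_mul, Complex.add_re, Complex.ofReal_re, Complex.re_ofReal_mul]
    have h3 : (θ * y' * (starRingEnd ℂ) y').re = θ.re * Complex.normSq y' := by
      rw [mul_assoc, Complex.mul_conj, Complex.re_mul_ofReal]
    rw [h1, add_mul, Complex.add_re, h2, h3]
    have := Complex.normSq_pos.2 hu0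
    have := Complex.normSq_nonneg y'
    positivity

theorem F_denominator_ne_zero {r : ℝ} (hr₀ : 0 < r) (hr₁ : r < 1) {ρ : ℝ} (hρ : 0 < ρ) (n : ℕ)
    {θ : ℂ} (hθ : 0 < θ.re) : ((n : ℂ) + 1) * F r ρ (n + 1) θ - ρ * F r ρ n θ ≠ 0 := by
  intro h
  have := re_pos_F hr₀ hr₁ hρ n hθ
  rw [h] at this
  simp at this

theorem F_denominator_eq_gammaSum {r : ℝ} (hr₀ : 0 < r) (hr₁ : r < 1) {ρ : ℝ} (hρ : ρ ≠ 0) (n : ℕ)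
    {θ : ℂ} (hθ : 0 < θ.re) : ((n : ℂ) + 1) * F r ρ (n + 1) θ - ρ * F r ρ n θ =
      (ρ : ℂ) ^ n / (n.factorial * Complex.Gamma θ) * gammaSum ρ n (θ + 1) := by
  have hθ0 : θ ≠ 0 := by rintro rfl; simp at hθ
  rw [F_succ_eq hr₀ hr₁, F_eq_gammaSum hr₀ hr₁ hρ n (θ := θ + 1) (by simp; linarith),
    Complex.Gamma_add_one _ hθ0]
  field_simp
  ring

theorem gammaSum_add_one_ne_zero {ρ : ℝ} (hρ : 0 < ρ) (n : ℕ) {θ : ℂ} (hθ : 0 < θ.re) :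
    gammaSum ρ n (θ + 1) ≠ 0 := by
  intro h
  -- The Gamma sum does not see the circle, so any radius in `(0, 1)` serves.
  refine F_denominator_ne_zero one_half_pos one_half_lt_one hρ n hθ ?_
  rw [F_denominator_eq_gammaSum one_half_pos one_half_lt_one hρ.ne' n hθ, h, mul_zero]

theorem jagermanIntegral_eq_gammaSum (ρ : ℝ) (m : ℕ) {θ : ℂ} (hθ : 0 < θ.re) :
    jagermanIntegral ρ m θ = gammaSum ρ m (θ + 1) := by
  have hre : ∀ l : ℕ, 0 < (θ + 1 + l).re := fun l => by
    have : (0 : ℝ) ≤ l := l.cast_nonneg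
    simp
    linarith
  have hterm : ∀ ξ ∈ Ioi (0 : ℝ),
      Complex.exp (-(ξ : ℂ)) * (ξ : ℂ) ^ θ * (1 + (ξ : ℂ) / (ρ : ℂ)) ^ m =
      ∑ l ∈ Finset.range (m + 1), ((m.choose l : ℂ) * ((ρ : ℂ) ^ l)⁻¹) *
        (((Real.exp (-ξ) : ℝ) : ℂ) * (ξ : ℂ) ^ (θ + 1 + l - 1)) := by
    intro ξ hξ
    have hξ0 : (ξ : ℂ) ≠ 0 := by exact_mod_cast (ne_of_gt hξ)
    rw [add_comm (1 : ℂ), add_pow, Finset.mul_sum]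
    refine Finset.sum_congr rfl fun l _ => ?_
    rw [show θ + 1 + (l : ℂ) - 1 = θ + l by ring, Complex.cpow_add _ _ hξ0, Complex.cpow_natCast,
      div_pow]
    push_cast
    ring
  rw [jagermanIntegral, setIntegral_congr_fun measurableSet_Ioi hterm, integral_finsetSum]
  · refine Finset.sum_congr rfl fun l _ => ?_
    rw [integral_const_mul, Complex.Gamma_eq_integral (hre l), Complex.GammaIntegral]
  · exact fun l _ => (Complex.GammaIntegral_convergent (hre l)).const_mul _

/-! ### The integrals `G_n` -/

/-- The function `e^{ρz} z^{-k} (z-1)^{-θ}`. -/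
def kernelG (ρ : ℝ) (k : ℕ) (θ z : ℂ) : ℂ :=
  Complex.exp ((ρ : ℂ) * z) / (z ^ k * (z - 1) ^ θ)

theorem ne_zero_of_sub_one_mem_slitPlane {z : ℂ} (hz : z - 1 ∈ Complex.slitPlane) : z ≠ 0 := by
  rintro rfl
  simp [Complex.mem_slitPlane_iff] at hz
  linarith

theorem hasDerivAt_kernelG (ρ : ℝ) (k : ℕ) (θ : ℂ) {z : ℂ} (hz : z - 1 ∈ Complex.slitPlane) :
    HasDerivAt (kernelG ρ k θ)
      ((ρ : ℂ) * kernelG ρ k θ z - θ * kernelG ρ k (θ + 1) z - (k : ℂ) * kernelG ρ (k + 1) θ z)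
      z := by
  have h1 : (z - 1) ≠ 0 := Complex.slitPlane_ne_zero hz
  have hz₀ := ne_zero_of_sub_one_mem_slitPlane hz
  have hp : (z - 1) ^ θ ≠ 0 := by simp [Complex.cpow_eq_zero_iff, h1]
  have hd1 : HasDerivAt (fun z : ℂ => Complex.exp ((ρ : ℂ) * z))
      (Complex.exp ((ρ : ℂ) * z) * (ρ * 1)) z := ((hasDerivAt_id z).const_mul (ρ : ℂ)).cexp
  have hd2 : HasDerivAt (fun z : ℂ => z ^ k) ((k : ℂ) * (z ^ k / z)) z := by
    refine (hasDerivAt_pow k z).congr_deriv ?_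
    cases k with
    | zero => simp
    | succ k => rw [pow_succ]; field_simp; simp
  have hd3 : HasDerivAt (fun z : ℂ => (z - 1) ^ θ) (θ * (z - 1) ^ (θ - 1) * 1) z :=
    ((hasDerivAt_id z).sub_const 1).cpow_const hz
  have hd := hd1.div (hd2.mul hd3) (mul_ne_zero (pow_ne_zero _ hz₀) hp)
  refine hd.congr_deriv ?_
  simp only [kernelG, Pi.mul_apply]
  rw [Complex.cpow_add _ _ h1, Complex.cpow_sub _ _ h1, Complex.cpow_one]
  field_simp
  ring

theorem continuousAt_kernelG (ρ : ℝ) (k : ℕ) (θ : ℂ) {z : ℂ} (hz : z - 1 ∈ Complex.slitPlane) :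
    ContinuousAt (kernelG ρ k θ) z := (hasDerivAt_kernelG ρ k θ hz).continuousAt

/-- The argument of `z - 1` is at most `π` in absolute value, which bounds the phase factor of the
complex power. Without a power of `z` no distance from `0` is needed; this matters when the contour
is collapsed onto the cut, which contains `0`. -/
theorem norm_kernelG_zero_le (ρ : ℝ) {θ z : ℂ} (hθ : 0 ≤ θ.re) {c : ℝ} (hc : 0 < c)
    (hz : c ≤ ‖z - 1‖) :
    ‖kernelG ρ 0 θ z‖ ≤ Real.exp (Real.pi * |θ.im|) * c ^ (-θ.re) * Real.exp (ρ * z.re) := by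
  have h1 : z - 1 ≠ 0 := norm_pos_iff.1 (hc.trans_le hz)
  have hre : ((ρ : ℂ) * z).re = ρ * z.re := by simp
  rw [kernelG, pow_zero, one_mul, norm_div, Complex.norm_exp, hre, Complex.norm_cpow_of_ne_zero h1,
    div_div_eq_mul_div, mul_div_assoc, mul_comm]
  gcongr
  rw [div_eq_mul_inv, ← Real.rpow_neg (norm_nonneg _)]
  have harg : (z - 1).arg * θ.im ≤ Real.pi * |θ.im| := by
    refine (le_abs_self _).trans ?_
    rw [abs_mul]
    gcongr
    exact Complex.abs_arg_le_pi _
  exact mul_le_mul (Real.exp_le_exp.2 harg) (Real.rpow_le_rpow_of_nonpos hc hz (neg_nonpos.2 hθ))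
    (Real.rpow_nonneg (norm_nonneg _) _) (Real.exp_pos _).le

theorem norm_kernelG_le (ρ : ℝ) (k : ℕ) {θ z : ℂ} (hθ : 0 ≤ θ.re) {c : ℝ} (hc : 0 < c)
    (hz₀ : c ≤ ‖z‖) (hz : c ≤ ‖z - 1‖) :
    ‖kernelG ρ k θ z‖ ≤
      (c ^ k)⁻¹ * (Real.exp (Real.pi * |θ.im|) * c ^ (-θ.re)) * Real.exp (ρ * z.re) := by
  have h : kernelG ρ k θ z = (z ^ k)⁻¹ * kernelG ρ 0 θ z := by
    simp only [kernelG, pow_zero, one_mul]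
    rw [div_mul_eq_div_div_swap, div_eq_inv_mul]
  rw [h, norm_mul, norm_inv, norm_pow, mul_assoc]
  gcongr
  exact norm_kernelG_zero_le ρ hθ hc hz

theorem norm_kernelG_line_le (ρ : ℝ) (k : ℕ) {θ : ℂ} (hθ : 0 ≤ θ.re) {c : ℝ} (hc : 0 < c) {b : ℝ}
    (hb : c ≤ |b|) (x : ℝ) : ‖kernelG ρ k θ (x + b * Complex.I)‖ ≤
      (c ^ k)⁻¹ * (Real.exp (Real.pi * |θ.im|) * c ^ (-θ.re)) * Real.exp (ρ * x) := by
  have h1 : c ≤ ‖(x + b * Complex.I : ℂ)‖ := by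
    refine hb.trans ?_
    simpa using Complex.abs_im_le_norm (x + b * Complex.I : ℂ)
  have h2 : c ≤ ‖(x + b * Complex.I - 1 : ℂ)‖ := by
    refine hb.trans ?_
    simpa using Complex.abs_im_le_norm (x + b * Complex.I - 1 : ℂ)
  simpa using norm_kernelG_le ρ k hθ hc h1 h2

theorem line_sub_one_mem_slitPlane (x : ℝ) {b : ℝ} (hb : b ≠ 0) :
    (x + b * Complex.I - 1 : ℂ) ∈ Complex.slitPlane := by
  right
  simpa using hb

theorem vertical_sub_one_mem_slitPlane {R : ℝ} (hR : 1 < R) (y : ℝ) :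
    (R + y * Complex.I - 1 : ℂ) ∈ Complex.slitPlane := by
  left
  simpa using hR

theorem continuous_kernelG_line (ρ : ℝ) (k : ℕ) (θ : ℂ) {b : ℝ} (hb : b ≠ 0) :
    Continuous fun x : ℝ => kernelG ρ k θ (x + b * Complex.I) := by
  refine continuous_iff_continuousAt.2 fun x => ?_
  exact ContinuousAt.comp (f := fun x : ℝ => (x + b * Complex.I : ℂ))
    (continuousAt_kernelG ρ k θ (line_sub_one_mem_slitPlane x hb)) (by fun_prop)

theorem continuous_kernelG_vertical (ρ : ℝ) (k : ℕ) (θ : ℂ) {R : ℝ} (hR : 1 < R) :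
    Continuous fun y : ℝ => kernelG ρ k θ (R + y * Complex.I) := by
  refine continuous_iff_continuousAt.2 fun y => ?_
  exact ContinuousAt.comp (f := fun y : ℝ => (R + y * Complex.I : ℂ))
    (continuousAt_kernelG ρ k θ (vertical_sub_one_mem_slitPlane hR y)) (by fun_prop)

theorem integrableOn_kernelG_line {ρ : ℝ} (hρ : 0 < ρ) (k : ℕ) {θ : ℂ} (hθ : 0 ≤ θ.re) {b : ℝ}
    (hb : b ≠ 0) (R : ℝ) :
    IntegrableOn (fun x : ℝ => kernelG ρ k θ (x + b * Complex.I)) (Iic R) :=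
  Integrable.mono' ((integrableOn_exp_mul_Iic hρ R).const_mul _)
    (continuous_kernelG_line ρ k θ hb).aestronglyMeasurable
    (Eventually.of_forall fun x => norm_kernelG_line_le ρ k hθ (abs_pos.2 hb) le_rfl x)

/-- The three integrals that make up `hankelIntegral ε R g` converge absolutely. -/
structure HankelIntegrable (ε R : ℝ) (g : ℂ → ℂ) : Prop where
  lower : IntegrableOn (fun x : ℝ => g (x - ε * Complex.I)) (Iic R)
  vertical : IntervalIntegrable (fun y : ℝ => g (R + y * Complex.I)) volume (-ε) ε
  upper : IntegrableOn (fun x : ℝ => g (x + ε * Complex.I)) (Iic R)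

theorem HankelIntegrable.const_mul {ε R : ℝ} {g : ℂ → ℂ} (hg : HankelIntegrable ε R g) (c : ℂ) :
    HankelIntegrable ε R fun z => c * g z :=
  ⟨hg.lower.const_mul c, hg.vertical.const_mul c, hg.upper.const_mul c⟩

theorem HankelIntegrable.sub {ε R : ℝ} {f g : ℂ → ℂ} (hf : HankelIntegrable ε R f)
    (hg : HankelIntegrable ε R g) : HankelIntegrable ε R fun z => f z - g z :=
  ⟨Integrable.sub hf.lower hg.lower, hf.vertical.sub hg.vertical,
    Integrable.sub hf.upper hg.upper⟩

theorem hankelIntegral_const_mul (ε R : ℝ) (g : ℂ → ℂ) (c : ℂ) :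
    hankelIntegral ε R (fun z => c * g z) = c * hankelIntegral ε R g := by
  simp only [hankelIntegral, integral_const_mul, intervalIntegral.integral_const_mul]
  ring

theorem hankelIntegral_sub {ε R : ℝ} {f g : ℂ → ℂ} (hf : HankelIntegrable ε R f)
    (hg : HankelIntegrable ε R g) :
    hankelIntegral ε R (fun z => f z - g z) = hankelIntegral ε R f - hankelIntegral ε R g := by
  simp only [hankelIntegral]
  rw [integral_sub hf.lower hg.lower, integral_sub hf.upper hg.upper,
    intervalIntegral.integral_sub hf.vertical hg.vertical]
  ring

theorem hankelIntegrable_kernelG {ε R ρ : ℝ} (hε : 0 < ε) (hR : 1 < R) (hρ : 0 < ρ) (k : ℕ) {θ : ℂ}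
    (hθ : 0 ≤ θ.re) : HankelIntegrable ε R (kernelG ρ k θ) where
  lower := by
    simpa [sub_eq_add_neg] using
      integrableOn_kernelG_line hρ k hθ (neg_ne_zero.2 hε.ne') R
  vertical := (continuous_kernelG_vertical ρ k θ hR).intervalIntegrable _ _
  upper := integrableOn_kernelG_line hρ k hθ hε.ne' R

theorem hankelIntegral_congr {ε R : ℝ} (hε : 0 < ε) (hR : 1 < R) {f g : ℂ → ℂ}
    (h : ∀ z, z - 1 ∈ Complex.slitPlane → f z = g z) :
    hankelIntegral ε R f = hankelIntegral ε R g := by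
  have h1 : ∀ x : ℝ, f (x - ε * Complex.I) = g (x - ε * Complex.I) := fun x => h _ <| by
    simpa [sub_eq_add_neg] using line_sub_one_mem_slitPlane x (neg_ne_zero.2 hε.ne')
  have h2 : ∀ x : ℝ, f (x + ε * Complex.I) = g (x + ε * Complex.I) := fun x =>
    h _ (line_sub_one_mem_slitPlane x hε.ne')
  have h3 : ∀ y : ℝ, f (R + y * Complex.I) = g (R + y * Complex.I) := fun y =>
    h _ (vertical_sub_one_mem_slitPlane hR y)
  simp only [hankelIntegral, h1, h2, h3]

theorem integral_kernelG_deriv_line {ρ : ℝ} (hρ : 0 < ρ) (k : ℕ) {θ : ℂ}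
    (hθ : 0 ≤ θ.re) {b : ℝ} (hb : b ≠ 0) (R : ℝ) {g' : ℂ → ℂ}
    (hd : ∀ z, z - 1 ∈ Complex.slitPlane → HasDerivAt (kernelG ρ k θ) (g' z) z)
    (hi : IntegrableOn (fun x : ℝ => g' (x + b * Complex.I)) (Iic R)) :
    ∫ x in Iic R, g' (x + b * Complex.I) = kernelG ρ k θ (R + b * Complex.I) := by
  have hder : ∀ x : ℝ, HasDerivAt (fun x : ℝ => kernelG ρ k θ (x + b * Complex.I))
      (g' (x + b * Complex.I)) x := fun x => by
    have h1 : HasDerivAt (fun x : ℝ => (x + b * Complex.I : ℂ)) 1 x :=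
      Complex.ofRealCLM.hasDerivAt.add_const _
    exact ((hd _ (line_sub_one_mem_slitPlane x hb)).scomp x h1).congr_deriv (one_smul _ _)
  have hlim : Tendsto (fun x : ℝ => kernelG ρ k θ (x + b * Complex.I)) atBot (𝓝 0) := by
    refine squeeze_zero_norm (norm_kernelG_line_le ρ k hθ (abs_pos.2 hb) le_rfl) ?_
    have : Tendsto (fun x : ℝ => Real.exp (ρ * x)) atBot (𝓝 0) :=
      Real.tendsto_exp_atBot.comp (tendsto_id.const_mul_atBot hρ)
    simpa using this.const_mul ((|b| ^ k)⁻¹ * (Real.exp (Real.pi * |θ.im|) * |b| ^ (-θ.re)))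
  rw [integral_Iic_of_hasDerivAt_of_tendsto
    (hder R).continuousAt.continuousWithinAt (fun x _ => hder x) hi hlim, sub_zero]

/-- Integration by parts on the Hankel contour. -/
theorem hankelIntegral_kernelG_succ {ε R ρ : ℝ} (hε : 0 < ε) (hR : 1 < R) (hρ : 0 < ρ) (k : ℕ)
    {θ : ℂ} (hθ : 0 ≤ θ.re) :
    (k : ℂ) * hankelIntegral ε R (kernelG ρ (k + 1) θ) =
      ρ * hankelIntegral ε R (kernelG ρ k θ) - θ * hankelIntegral ε R (kernelG ρ k (θ + 1)) := by
  have hθ' : 0 ≤ (θ + 1).re := by simp; linarith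
  have hA := (hankelIntegrable_kernelG hε hR hρ k hθ).const_mul (ρ : ℂ)
  have hB := (hankelIntegrable_kernelG hε hR hρ k hθ').const_mul θ
  have hC := (hankelIntegrable_kernelG hε hR hρ (k + 1) hθ).const_mul (k : ℂ)
  have hint := (hA.sub hB).sub hC
  set g' : ℂ → ℂ := fun z => (ρ : ℂ) * kernelG ρ k θ z - θ * kernelG ρ k (θ + 1) z -
    (k : ℂ) * kernelG ρ (k + 1) θ z with hg'
  have hd : ∀ z, z - 1 ∈ Complex.slitPlane → HasDerivAt (kernelG ρ k θ) (g' z) z :=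
    fun z hz => hasDerivAt_kernelG ρ k θ hz
  -- `g'` has the antiderivative `kernelG ρ k θ`, which vanishes at both infinite ends; the values
  -- at the corners `R ± iε` cancel.
  have hzero : hankelIntegral ε R g' = 0 := by
    have hl : ∫ x in Iic R, g' (x - ε * Complex.I) = kernelG ρ k θ (R - ε * Complex.I) := by
      have h := integral_kernelG_deriv_line hρ k hθ (neg_ne_zero.2 hε.ne') R hd
        (by simpa [sub_eq_add_neg] using hint.lower)
      simpa [sub_eq_add_neg] using h
    have hu : ∫ x in Iic R, g' (x + ε * Complex.I) = kernelG ρ k θ (R + ε * Complex.I) :=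
      integral_kernelG_deriv_line hρ k hθ hε.ne' R hd hint.upper
    have hv : Complex.I * ∫ y in (-ε)..ε, g' (R + y * Complex.I) =
        kernelG ρ k θ (R + ε * Complex.I) - kernelG ρ k θ (R - ε * Complex.I) := by
      rw [← intervalIntegral.integral_const_mul, intervalIntegral.integral_eq_sub_of_hasDerivAt
        (f := fun y : ℝ => kernelG ρ k θ (R + y * Complex.I)) _ (hint.vertical.const_mul _)]
      · simp [sub_eq_add_neg]
      · intro y _
        have h1 : HasDerivAt (fun y : ℝ => (R + y * Complex.I : ℂ)) Complex.I y := by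
          simpa using (Complex.ofRealCLM.hasDerivAt (x := y)).mul_const Complex.I |>.const_add (R : ℂ)
        exact (hd _ (vertical_sub_one_mem_slitPlane hR y)).scomp y h1
    rw [hankelIntegral, hl, hu, hv]
    ring
  rw [hg', hankelIntegral_sub (hA.sub hB) hC, hankelIntegral_sub hA hB] at hzero
  simp only [hankelIntegral_const_mul] at hzero
  linear_combination -hzero

theorem hankelIntegral_kernelG_add_one {ε R ρ : ℝ} (hε : 0 < ε) (hR : 1 < R) (hρ : 0 < ρ) (k : ℕ)
    {θ : ℂ} (hθ : 0 ≤ θ.re) :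
    hankelIntegral ε R (kernelG ρ k (θ + 1)) - hankelIntegral ε R (kernelG ρ (k + 1) (θ + 1)) =
      hankelIntegral ε R (kernelG ρ (k + 1) θ) := by
  have hθ' : 0 ≤ (θ + 1).re := by simp; linarith
  rw [← hankelIntegral_sub (hankelIntegrable_kernelG hε hR hρ _ hθ')
    (hankelIntegrable_kernelG hε hR hρ _ hθ')]
  refine hankelIntegral_congr hε hR fun z hz => ?_
  have h1 : (z - 1) ≠ 0 := Complex.slitPlane_ne_zero hz
  have hz₀ := ne_zero_of_sub_one_mem_slitPlane hz
  have hp : (z - 1) ^ θ ≠ 0 := by simp [Complex.cpow_eq_zero_iff, h1]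
  simp only [kernelG]
  rw [Complex.cpow_add _ _ h1, Complex.cpow_one]
  field_simp
  ring

/-! #### Deformation of the contour -/

/-- Cauchy's theorem on the rectangle with real parts in `[X, R]` and imaginary parts between `a`
and `b`, with `X → -∞`: the far side decays like `e^{ρX}`. Since `|y| ≥ c > 0` throughout, the
rectangle avoids the cut. -/
theorem integral_kernelG_line_sub {ρ : ℝ} (hρ : 0 < ρ) (k : ℕ) {θ : ℂ} (hθ : 0 ≤ θ.re) {a b c : ℝ}
    (hc : 0 < c) (hab : ∀ y ∈ uIcc a b, c ≤ |y|) (R : ℝ) :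
    (∫ x in Iic R, kernelG ρ k θ (x + a * Complex.I)) -
        (∫ x in Iic R, kernelG ρ k θ (x + b * Complex.I)) +
      Complex.I * ∫ y in a..b, kernelG ρ k θ (R + y * Complex.I) = 0 := by
  have hne : ∀ y ∈ uIcc a b, y ≠ 0 := fun y hy => abs_pos.1 (hc.trans_le (hab y hy))
  have ha := integrableOn_kernelG_line hρ k hθ (hne a left_mem_uIcc) R
  have hb := integrableOn_kernelG_line hρ k hθ (hne b right_mem_uIcc) R
  have hrect : ∀ X : ℝ, (((∫ x in X..R, kernelG ρ k θ (x + a * Complex.I)) -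
      (∫ x in X..R, kernelG ρ k θ (x + b * Complex.I))) +
      Complex.I * ∫ y in a..b, kernelG ρ k θ (R + y * Complex.I)) -
      Complex.I * ∫ y in a..b, kernelG ρ k θ (X + y * Complex.I) = 0 := by
    intro X
    have h := Complex.integral_boundary_rect_eq_zero_of_differentiableOn (kernelG ρ k θ)
      (X + a * Complex.I) (R + b * Complex.I) (fun z hz => by
        have him : z.im ∈ uIcc a b := by simpa using hz.2
        have hs : z - 1 ∈ Complex.slitPlane := by
          right
          simpa using hne _ him
        exact (hasDerivAt_kernelG ρ k θ hs).differentiableAt.differentiableWithinAt)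
    simpa using h
  have hside : Tendsto (fun X : ℝ => ∫ y in a..b, kernelG ρ k θ (X + y * Complex.I)) atBot
      (𝓝 0) := by
    set C := (c ^ k)⁻¹ * (Real.exp (Real.pi * |θ.im|) * c ^ (-θ.re))
    refine squeeze_zero_norm (a := fun X => C * Real.exp (ρ * X) * |b - a|) (fun X => ?_) ?_
    · exact intervalIntegral.norm_integral_le_of_norm_le_const fun y hy =>
        norm_kernelG_line_le ρ k hθ hc (hab y (uIoc_subset_uIcc hy)) X
    · have : Tendsto (fun x : ℝ => Real.exp (ρ * x)) atBot (𝓝 0) :=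
        Real.tendsto_exp_atBot.comp (tendsto_id.const_mul_atBot hρ)
      simpa using (this.const_mul C).mul_const |b - a|
  have hlim := ((((intervalIntegral_tendsto_integral_Iic R ha tendsto_id).sub
    (intervalIntegral_tendsto_integral_Iic R hb tendsto_id)).add_const
    (Complex.I * ∫ y in a..b, kernelG ρ k θ (R + y * Complex.I)))).sub
    (hside.const_mul Complex.I)
  simp only [id, hrect, mul_zero, sub_zero] at hlim
  exact tendsto_nhds_unique tendsto_const_nhds hlim |>.symm

/-- One rectangle above the cut and one below. The value is therefore unchanged when the contour is
collapsed onto the cut by `ε → 0`. -/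
theorem hankelIntegral_kernelG_eq {ε ε' R ρ : ℝ} (hε : 0 < ε) (hε' : 0 < ε') (hR : 1 < R)
    (hρ : 0 < ρ) (k : ℕ) {θ : ℂ} (hθ : 0 ≤ θ.re) :
    hankelIntegral ε R (kernelG ρ k θ) = hankelIntegral ε' R (kernelG ρ k θ) := by
  have hc : 0 < min ε ε' := lt_min hε hε'
  have hu := integral_kernelG_line_sub (a := ε) (b := ε') hρ k hθ hc
    (fun y hy => hy.1.trans (le_abs_self y)) R
  have hl := integral_kernelG_line_sub (a := -ε) (b := -ε') hρ k hθ hc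
    (fun y hy => by
      have := hy.2
      rw [max_neg_neg] at this
      have := neg_le_abs y
      linarith) R
  have hv : ∀ s t : ℝ, IntervalIntegrable (fun y : ℝ => kernelG ρ k θ (R + y * Complex.I))
      volume s t := fun s t => (continuous_kernelG_vertical ρ k θ hR).intervalIntegrable s t
  have h1 := intervalIntegral.integral_add_adjacent_intervals (hv (-ε) (-ε')) (hv (-ε') ε')
  have h2 := intervalIntegral.integral_add_adjacent_intervals (hv (-ε) ε) (hv ε ε')
  simp only [Complex.ofReal_neg, neg_mul, ← sub_eq_add_neg] at hl
  simp only [hankelIntegral]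
  linear_combination hl - hu + Complex.I * (h2 - h1)

/-! #### Hankel's formula for the Gamma function -/

/-- The dominating function for the collapse of the contour; its singularity at `1` is integrable
only because `s < 1`. -/
theorem integrableOn_exp_mul_abs_sub_one_rpow {ρ : ℝ} (hρ : 0 < ρ) {s : ℝ} (hs₀ : 0 ≤ s)
    (hs₁ : s < 1) {R : ℝ} (hR : 1 < R) :
    IntegrableOn (fun x : ℝ => |x - 1| ^ (-s) * Real.exp (ρ * x)) (Iic R) := by
  have hmeas : Measurable fun x : ℝ => |x - 1| ^ (-s) * Real.exp (ρ * x) := by fun_prop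
  have h0 : IntegrableOn (fun x : ℝ => |x - 1| ^ (-s) * Real.exp (ρ * x)) (Iic 0) := by
    refine Integrable.mono' (integrableOn_exp_mul_Iic hρ 0) hmeas.aestronglyMeasurable ?_
    refine (ae_restrict_mem measurableSet_Iic).mono fun x hx => ?_
    rw [Real.norm_of_nonneg (by positivity)]
    refine mul_le_of_le_one_left (Real.exp_pos _).le (Real.rpow_le_one_of_one_le_of_nonpos ?_
      (by linarith))
    rw [abs_sub_comm]
    exact (by linarith [mem_Iic.1 hx] : (1 : ℝ) ≤ 1 - x).trans (le_abs_self _)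
  have hint : ∀ a b : ℝ, IntervalIntegrable (fun x : ℝ => x ^ (-s)) volume a b :=
    fun a b => intervalIntegral.intervalIntegrable_rpow' (by linarith)
  have h1 : IntervalIntegrable (fun x : ℝ => |x - 1| ^ (-s)) volume 0 1 := by
    have h := (hint 1 0).comp_sub_left 1
    simp only [sub_self, sub_zero] at h
    refine h.congr fun x hx => ?_
    rw [uIoc_of_le zero_le_one] at hx
    rw [abs_sub_comm, abs_of_nonneg (by linarith [hx.2])]
  have h2 : IntervalIntegrable (fun x : ℝ => |x - 1| ^ (-s)) volume 1 R := by
    have h := (hint 0 (R - 1)).comp_sub_right 1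
    simp only [zero_add, sub_add_cancel] at h
    refine h.congr fun x hx => ?_
    rw [uIoc_of_le hR.le] at hx
    rw [abs_of_nonneg (by linarith [hx.1])]
  have h3 : IntegrableOn (fun x : ℝ => |x - 1| ^ (-s) * Real.exp (ρ * x)) (Ioc 0 R) :=
    (intervalIntegrable_iff_integrableOn_Ioc_of_le (by linarith)).1
      ((h1.trans h2).mul_continuousOn (by fun_prop))
  rw [← Iic_union_Ioc_eq_Iic (show (0 : ℝ) ≤ R by linarith)]
  exact h0.union h3

/-- The logarithm of `z - 1` tends to `log |x - 1| ∓ iπ` from below and above the cut. The two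
powers thus differ by the phases `e^{±iπθ}`, whose difference is `2i sin(πθ)`. -/
theorem tendsto_kernelG_zero_line (ρ : ℝ) (θ : ℂ) {x : ℝ} (hx : x < 1) :
    Tendsto (fun ε : ℝ => kernelG ρ 0 θ (x - ε * Complex.I) - kernelG ρ 0 θ (x + ε * Complex.I))
      (𝓝[>] 0) (𝓝 (2 * Complex.I * Complex.sin (Real.pi * θ) * Complex.exp ρ *
        (((1 - x : ℝ) : ℂ) ^ (1 - θ - 1) * Complex.exp (-(ρ * ((1 - x : ℝ) : ℂ)))))) := by
  have hre : ((x : ℂ) - 1).re < 0 := by simpa using hx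
  have him : ((x : ℂ) - 1).im = 0 := by simp
  have hne : ∀ {z : ℂ}, z.im ≠ 0 → z - 1 ≠ 0 := fun hz h => hz (by simpa using congrArg Complex.im h)
  have hlow : Tendsto (fun ε : ℝ => Complex.log (x - ε * Complex.I - 1)) (𝓝[>] 0)
      (𝓝 (Real.log ‖(x : ℂ) - 1‖ - Real.pi * Complex.I)) := by
    refine (Complex.tendsto_log_nhdsWithin_im_neg_of_re_neg_of_im_zero hre him).comp ?_
    refine tendsto_nhdsWithin_iff.2 ⟨?_, ?_⟩
    · have : Continuous fun ε : ℝ => (x - ε * Complex.I - 1 : ℂ) := by fun_prop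
      simpa using (this.tendsto 0).mono_left nhdsWithin_le_nhds
    · filter_upwards [self_mem_nhdsWithin] with ε hε
      simpa using hε
  have hup : Tendsto (fun ε : ℝ => Complex.log (x + ε * Complex.I - 1)) (𝓝[>] 0)
      (𝓝 (Real.log ‖(x : ℂ) - 1‖ + Real.pi * Complex.I)) := by
    refine (Complex.tendsto_log_nhdsWithin_im_nonneg_of_re_neg_of_im_zero hre him).comp ?_
    refine tendsto_nhdsWithin_iff.2 ⟨?_, ?_⟩
    · have : Continuous fun ε : ℝ => (x + ε * Complex.I - 1 : ℂ) := by fun_prop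
      simpa using (this.tendsto 0).mono_left nhdsWithin_le_nhds
    · filter_upwards [self_mem_nhdsWithin] with ε hε
      simpa using (mem_Ioi.1 hε).le
  have hexp : ∀ s : ℝ, Tendsto (fun ε : ℝ => (ρ : ℂ) * (x + s * ε * Complex.I)) (𝓝[>] 0)
      (𝓝 (ρ * x)) := fun s => by
    have : Continuous fun ε : ℝ => ((ρ : ℂ) * (x + s * ε * Complex.I) : ℂ) := by fun_prop
    simpa using (this.tendsto 0).mono_left nhdsWithin_le_nhds
  have hker : ∀ {z : ℂ}, z.im ≠ 0 →
      kernelG ρ 0 θ z = Complex.exp (ρ * z - Complex.log (z - 1) * θ) := fun {z} hz => by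
    rw [kernelG, pow_zero, one_mul, Complex.cpow_def_of_ne_zero (hne hz), Complex.exp_sub]
  have hA : Tendsto (fun ε : ℝ => kernelG ρ 0 θ (x - ε * Complex.I)) (𝓝[>] 0)
      (𝓝 (Complex.exp (ρ * x - (Real.log ‖(x : ℂ) - 1‖ - Real.pi * Complex.I) * θ))) := by
    refine ((hexp (-1)).sub (hlow.mul_const θ)).cexp.congr' ?_
    filter_upwards [self_mem_nhdsWithin] with ε hε
    rw [hker (by simpa using (mem_Ioi.1 hε).ne')]
    congr 3
    push_cast
    ring
  have hB : Tendsto (fun ε : ℝ => kernelG ρ 0 θ (x + ε * Complex.I)) (𝓝[>] 0)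
      (𝓝 (Complex.exp (ρ * x - (Real.log ‖(x : ℂ) - 1‖ + Real.pi * Complex.I) * θ))) := by
    refine ((hexp 1).sub (hup.mul_const θ)).cexp.congr' ?_
    filter_upwards [self_mem_nhdsWithin] with ε hε
    rw [hker (by simpa using (mem_Ioi.1 hε).ne')]
    congr 3
    push_cast
    ring
  convert hA.sub hB using 2
  have h1x : ((1 - x : ℝ) : ℂ) ≠ 0 := by exact_mod_cast (sub_pos.2 hx).ne'
  have hnorm : ‖(x : ℂ) - 1‖ = 1 - x := by
    rw [← Complex.ofReal_one, ← Complex.ofReal_sub, Complex.norm_real, Real.norm_eq_abs,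
      abs_sub_comm, abs_of_pos (sub_pos.2 hx)]
  rw [hnorm, Complex.ofReal_log (sub_pos.2 hx).le, Complex.cpow_def_of_ne_zero h1x, Complex.sin]
  set l := Complex.log ((1 - x : ℝ) : ℂ)
  have e1 : Complex.exp (ρ * x - (l - Real.pi * Complex.I) * θ) =
      Complex.exp ρ * (Complex.exp (l * (1 - θ - 1)) * Complex.exp (-(ρ * ((1 - x : ℝ) : ℂ)))) *
        Complex.exp (Real.pi * θ * Complex.I) := by
    simp only [← Complex.exp_add]
    congr 1
    push_cast
    ring
  have e2 : Complex.exp (ρ * x - (l + Real.pi * Complex.I) * θ) =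
      Complex.exp ρ * (Complex.exp (l * (1 - θ - 1)) * Complex.exp (-(ρ * ((1 - x : ℝ) : ℂ)))) *
        Complex.exp (-(Real.pi * θ) * Complex.I) := by
    simp only [← Complex.exp_add]
    congr 1
    push_cast
    ring
  rw [e1, e2]
  generalize Complex.exp (Real.pi * θ * Complex.I) = A
  generalize Complex.exp (-(Real.pi * θ) * Complex.I) = B
  ring_nf
  rw [Complex.I_sq]
  ring

theorem integral_Iio_one_eq (ψ : ℝ → ℂ) :
    ∫ x in Iio (1 : ℝ), ψ (1 - x) = ∫ u in Ioi (0 : ℝ), ψ u := by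
  rw [← integral_indicator measurableSet_Ioi, ← integral_indicator measurableSet_Iio,
    ← integral_sub_left_eq_self _ _ (1 : ℝ)]
  congr 1
  ext x
  simp only [indicator, mem_Iio, mem_Ioi, sub_lt_self_iff, sub_sub_cancel]

/-- As the contour collapses, the vertical segment disappears and the horizontal parts cancel to the
right of `1`. The jump across the cut remains, and with `u = 1 - x` it is a Gamma integral. -/
theorem hankelIntegral_kernelG_zero_of_re_lt_one {ε R ρ : ℝ} (hε : 0 < ε) (hR : 1 < R) (hρ : 0 < ρ)
    {θ : ℂ} (hθ₀ : 0 < θ.re) (hθ₁ : θ.re < 1) :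
    hankelIntegral ε R (kernelG ρ 0 θ) = 2 * Complex.I * Complex.sin (Real.pi * θ) *
      Complex.exp ρ * ((1 / ρ : ℂ) ^ (1 - θ) * Complex.Gamma (1 - θ)) := by
  set ψ : ℝ → ℂ := fun u => (u : ℂ) ^ (1 - θ - 1) * Complex.exp (-(ρ * (u : ℂ))) with hψ
  set c := 2 * Complex.I * Complex.sin (Real.pi * θ) * Complex.exp ρ
  set E := Real.exp (Real.pi * |θ.im|)
  have hlines : Tendsto (fun ε : ℝ => ∫ x in Iic R, (kernelG ρ 0 θ (x - ε * Complex.I) -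
      kernelG ρ 0 θ (x + ε * Complex.I))) (𝓝[>] 0)
      (𝓝 (∫ x in Iic R, (Iio 1).indicator (fun x => c * ψ (1 - x)) x)) := by
    refine tendsto_integral_filter_of_dominated_convergence
      (fun x => 2 * E * (|x - 1| ^ (-θ.re) * Real.exp (ρ * x))) ?_ ?_
      ((integrableOn_exp_mul_abs_sub_one_rpow hρ hθ₀.le hθ₁ hR).const_mul _) ?_
    · filter_upwards [self_mem_nhdsWithin] with δ hδ
      have h1 := continuous_kernelG_line ρ 0 θ (mem_Ioi.1 hδ).ne'
      have h2 := continuous_kernelG_line ρ 0 θ (neg_ne_zero.2 (mem_Ioi.1 hδ).ne')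
      simp only [Complex.ofReal_neg, neg_mul, ← sub_eq_add_neg] at h2
      exact (h2.sub h1).aestronglyMeasurable
    · refine Eventually.of_forall fun δ => ?_
      refine (ae_restrict_of_ae (Measure.ae_ne volume (1 : ℝ))).mono fun x hx => ?_
      have hc : 0 < |x - 1| := abs_pos.2 (sub_ne_zero.2 hx)
      have hb : ∀ t : ℝ, ‖kernelG ρ 0 θ (x + t * Complex.I)‖ ≤
          E * |x - 1| ^ (-θ.re) * Real.exp (ρ * x) := fun t => by
        have h := norm_kernelG_zero_le ρ (z := x + t * Complex.I) hθ₀.le hc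
          (by simpa using Complex.abs_re_le_norm (x + t * Complex.I - 1 : ℂ))
        simpa using h
      have h1 := hb δ
      have h2 := hb (-δ)
      simp only [Complex.ofReal_neg, neg_mul, ← sub_eq_add_neg] at h2
      refine (norm_sub_le _ _).trans ?_
      linarith
    · refine (ae_restrict_of_ae (Measure.ae_ne volume (1 : ℝ))).mono fun x hx => ?_
      rcases lt_or_gt_of_ne hx with hx | hx
      · rw [indicator_of_mem (mem_Iio.2 hx)]
        exact tendsto_kernelG_zero_line ρ θ hx
      · rw [indicator_of_notMem (by simpa using hx.le)]
        have hs : (x : ℂ) - 1 ∈ Complex.slitPlane := by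
          left
          simpa using hx
        have hk := continuousAt_kernelG ρ 0 θ hs
        have h1 : Tendsto (fun δ : ℝ => (x - δ * Complex.I : ℂ)) (𝓝[>] 0) (𝓝 x) := by
          have : Continuous fun δ : ℝ => (x - δ * Complex.I : ℂ) := by fun_prop
          simpa using (this.tendsto 0).mono_left nhdsWithin_le_nhds
        have h2 : Tendsto (fun δ : ℝ => (x + δ * Complex.I : ℂ)) (𝓝[>] 0) (𝓝 x) := by
          have : Continuous fun δ : ℝ => (x + δ * Complex.I : ℂ) := by fun_prop
          simpa using (this.tendsto 0).mono_left nhdsWithin_le_nhds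
        simpa using (hk.tendsto.comp h1).sub (hk.tendsto.comp h2)
  have hvert : Tendsto (fun δ : ℝ => ∫ y in (-δ)..δ, kernelG ρ 0 θ (R + y * Complex.I)) (𝓝[>] 0)
      (𝓝 0) := by
    refine squeeze_zero_norm
      (a := fun δ => E * (R - 1) ^ (-θ.re) * Real.exp (ρ * R) * |δ - -δ|) (fun δ => ?_) ?_
    · refine intervalIntegral.norm_integral_le_of_norm_le_const fun y _ => ?_
      have h := norm_kernelG_zero_le ρ (z := R + y * Complex.I) hθ₀.le (sub_pos.2 hR)
        ((le_abs_self _).trans (by simpa using Complex.abs_re_le_norm (R + y * Complex.I - 1 : ℂ)))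
      simpa using h
    · have : Continuous fun δ : ℝ => E * (R - 1) ^ (-θ.re) * Real.exp (ρ * R) * |δ - -δ| := by
        fun_prop
      simpa using (this.tendsto 0).mono_left nhdsWithin_le_nhds
  have hconst : Tendsto (fun δ : ℝ => hankelIntegral δ R (kernelG ρ 0 θ)) (𝓝[>] 0)
      (𝓝 (hankelIntegral ε R (kernelG ρ 0 θ))) := by
    refine tendsto_const_nhds.congr' ?_
    filter_upwards [self_mem_nhdsWithin] with δ hδ
    exact hankelIntegral_kernelG_eq hε hδ hR hρ 0 hθ₀.le
  have hsum := hlines.add (hvert.const_mul Complex.I)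
  rw [mul_zero, add_zero] at hsum
  have heq := tendsto_nhds_unique hconst (hsum.congr' (by
    filter_upwards [self_mem_nhdsWithin] with δ hδ
    have hi := hankelIntegrable_kernelG (mem_Ioi.1 hδ) hR hρ 0 hθ₀.le
    rw [integral_sub hi.lower hi.upper, hankelIntegral]
    ring))
  rw [heq, setIntegral_indicator measurableSet_Iio, inter_eq_right.2 (fun x hx => mem_Iic.2 ((mem_Iio.1 hx).le.trans hR.le)),
    integral_const_mul, integral_Iio_one_eq ψ, hψ,
    Complex.integral_cpow_mul_exp_neg_mul_Ioi (by simpa using hθ₁) hρ]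

/-- Needed to reach the line `Re θ = 1`, where the collapse of the contour is no longer integrable.
-/
theorem continuousAt_hankelIntegral_kernelG_zero {ε R ρ : ℝ} (hε : 0 < ε) (hR : 1 < R) (hρ : 0 < ρ)
    {θ : ℂ} (hθ : 0 < θ.re) :
    ContinuousAt (fun θ => hankelIntegral ε R (kernelG ρ 0 θ)) θ := by
  have hev : ∀ᶠ t : ℂ in 𝓝 θ, 0 ≤ t.re :=
    (Complex.continuous_re.tendsto θ).eventually (eventually_ge_nhds hθ)
  have hbound : ∀ c : ℝ, 0 < c → ∀ᶠ t : ℂ in 𝓝 θ, Real.exp (Real.pi * |t.im|) * c ^ (-t.re) ≤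
      Real.exp (Real.pi * |θ.im|) * c ^ (-θ.re) + 1 := fun c hc => by
    have hcont : Continuous fun t : ℂ => Real.exp (Real.pi * |t.im|) * c ^ (-t.re) := by
      refine Continuous.mul (by fun_prop) ?_
      exact (Real.continuous_const_rpow hc.ne').comp (by fun_prop)
    exact (hcont.tendsto θ).eventually (eventually_le_nhds (lt_add_one _))
  have hpt : ∀ z : ℂ, z - 1 ≠ 0 → ContinuousAt (fun t => kernelG ρ 0 t z) θ := fun z hz => by
    simp only [kernelG, pow_zero, one_mul]
    exact continuousAt_const.div (continuousAt_const_cpow hz)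
      (by simp [Complex.cpow_eq_zero_iff, hz])
  have hline : ∀ b : ℝ, b ≠ 0 →
      ContinuousAt (fun t => ∫ x in Iic R, kernelG ρ 0 t (x + b * Complex.I)) θ := fun b hb => by
    refine continuousAt_of_dominated
      (bound := fun x => (Real.exp (Real.pi * |θ.im|) * |b| ^ (-θ.re) + 1) * Real.exp (ρ * x))
      (Eventually.of_forall fun t => (continuous_kernelG_line ρ 0 t hb).aestronglyMeasurable)
      ?_ ((integrableOn_exp_mul_Iic hρ R).const_mul _)
      (Eventually.of_forall fun x =>
        hpt _ (Complex.slitPlane_ne_zero (line_sub_one_mem_slitPlane x hb)))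
    filter_upwards [hev, hbound _ (abs_pos.2 hb)] with t ht hbt
    refine Eventually.of_forall fun x => ?_
    refine (norm_kernelG_line_le ρ 0 ht (abs_pos.2 hb) le_rfl x).trans ?_
    rw [pow_zero, inv_one, one_mul]
    gcongr
  have hvert : ContinuousAt (fun t => ∫ y in (-ε)..ε, kernelG ρ 0 t (R + y * Complex.I)) θ := by
    refine intervalIntegral.continuousAt_of_dominated_interval
      (bound := fun _ => (Real.exp (Real.pi * |θ.im|) * (R - 1) ^ (-θ.re) + 1) * Real.exp (ρ * R))
      (Eventually.of_forall fun t => (continuous_kernelG_vertical ρ 0 t hR).aestronglyMeasurable)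
      ?_ intervalIntegrable_const
      (Eventually.of_forall fun y _ =>
        hpt _ (Complex.slitPlane_ne_zero (vertical_sub_one_mem_slitPlane hR y)))
    filter_upwards [hev, hbound _ (sub_pos.2 hR)] with t ht hbt
    refine Eventually.of_forall fun y _ => ?_
    have h := norm_kernelG_zero_le ρ (z := R + y * Complex.I) ht (sub_pos.2 hR)
      ((le_abs_self _).trans (by simpa using Complex.abs_re_le_norm (R + y * Complex.I - 1 : ℂ)))
    refine h.trans ?_
    simp only [Complex.add_re, Complex.ofReal_re, Complex.re_ofReal_mul, Complex.I_re, mul_zero,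
      add_zero]
    gcongr
  have hlow := hline (-ε) (neg_ne_zero.2 hε.ne')
  simp only [Complex.ofReal_neg, neg_mul, ← sub_eq_add_neg] at hlow
  exact (hlow.add (continuousAt_const.mul hvert)).sub (hline ε hε.ne')

/-- Hankel's integral representation of `1 / Γ(θ)`. -/
theorem Gamma_mul_hankelIntegral {ε R ρ : ℝ} (hε : 0 < ε) (hR : 1 < R) (hρ : 0 < ρ) {θ : ℂ}
    (hθ : 0 < θ.re) :
    Complex.Gamma θ * (ρ * hankelIntegral ε R (kernelG ρ 0 θ)) =
      2 * Real.pi * Complex.I * (Complex.exp ρ * (ρ : ℂ) ^ θ) := by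
  have hρ0 : (ρ : ℂ) ≠ 0 := by exact_mod_cast hρ.ne'
  -- On the open strip the collapsed contour and Euler's reflection formula give the claim.
  have hstrip : ∀ θ : ℂ, 0 < θ.re → θ.re < 1 →
      Complex.Gamma θ * (ρ * hankelIntegral ε R (kernelG ρ 0 θ)) =
        2 * Real.pi * Complex.I * (Complex.exp ρ * (ρ : ℂ) ^ θ) := fun θ h₀ h₁ => by
    have hrefl := Complex.Gamma_mul_Gamma_one_sub θ
    have hG1 := Complex.Gamma_ne_zero_of_re_pos h₀
    have hG2 := Complex.Gamma_ne_zero_of_re_pos (s := 1 - θ) (by simpa using h₁)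
    have hsin : Complex.sin (Real.pi * θ) ≠ 0 := by
      intro h
      rw [h, div_zero] at hrefl
      exact mul_ne_zero hG1 hG2 hrefl
    rw [eq_div_iff hsin] at hrefl
    have hpow : (1 / ρ : ℂ) ^ (1 - θ) = (ρ : ℂ) ^ θ / ρ := by
      rw [one_div, Complex.inv_cpow _ _ (by rw [Complex.arg_ofReal_of_nonneg hρ.le]; exact
        Real.pi_pos.ne), Complex.cpow_sub _ _ hρ0, Complex.cpow_one, inv_div]
    rw [hankelIntegral_kernelG_zero_of_re_lt_one hε hR hρ h₀ h₁, hpow]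
    field_simp
    linear_combination ((ρ : ℂ) ^ θ) * hrefl
  -- Unit shifts of the open strip would miss integer real parts, so the line `Re θ = 1` is added by
  -- continuity from the left.
  have hbase : ∀ θ : ℂ, 0 < θ.re → θ.re ≤ 1 →
      Complex.Gamma θ * (ρ * hankelIntegral ε R (kernelG ρ 0 θ)) =
        2 * Real.pi * Complex.I * (Complex.exp ρ * (ρ : ℂ) ^ θ) := fun θ h₀ h₁ => by
    rcases h₁.lt_or_eq with h₁ | h₁
    · exact hstrip θ h₀ h₁
    have hseq : Tendsto (fun s : ℝ => θ - s) (𝓝[>] 0) (𝓝 θ) := by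
      have : Continuous fun s : ℝ => θ - s := by fun_prop
      simpa using (this.tendsto 0).mono_left nhdsWithin_le_nhds
    have hcL : ContinuousAt (fun θ => Complex.Gamma θ *
        (ρ * hankelIntegral ε R (kernelG ρ 0 θ))) θ := by
      refine ContinuousAt.mul ?_
        (continuousAt_const.mul (continuousAt_hankelIntegral_kernelG_zero hε hR hρ h₀))
      refine (Complex.differentiableAt_Gamma θ fun n h => ?_).continuousAt
      rw [h] at h₀
      have : (0 : ℝ) ≤ n := n.cast_nonneg
      simp at h₀
      linarith
    have hcR : ContinuousAt (fun θ => 2 * Real.pi * Complex.I *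
        (Complex.exp ρ * (ρ : ℂ) ^ θ)) θ :=
      continuousAt_const.mul (continuousAt_const.mul (continuousAt_const_cpow hρ0))
    refine tendsto_nhds_unique (hcL.tendsto.comp hseq) ((hcR.tendsto.comp hseq).congr' ?_)
    filter_upwards [Ioo_mem_nhdsGT (zero_lt_one' ℝ)] with s hs
    exact (hstrip (θ - s) (by simp [h₁, hs.2]) (by simp [h₁, hs.1])).symm
  -- Integration by parts with `k = 0` relates `θ - 1` to `θ`, in step with `Γ(θ) = (θ - 1) Γ(θ -
  -- 1)`.
  have hall : ∀ n : ℕ, ∀ θ : ℂ, 0 < θ.re → θ.re ≤ n + 1 →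
      Complex.Gamma θ * (ρ * hankelIntegral ε R (kernelG ρ 0 θ)) =
        2 * Real.pi * Complex.I * (Complex.exp ρ * (ρ : ℂ) ^ θ) := fun n => by
    induction n with
    | zero => simpa using hbase
    | succ n ih =>
      intro θ h₀ h₁
      rcases le_or_gt θ.re 1 with h | h
      · exact hbase θ h₀ h
      have h₀' : 0 < (θ - 1).re := by simpa using h
      have hprev := ih (θ - 1) h₀' (by simp at h₁ ⊢; linarith)
      have hparts := hankelIntegral_kernelG_succ hε hR hρ 0 (θ := θ - 1) h₀'.le
      have hne : θ - 1 ≠ 0 := by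
        intro h0
        rw [h0] at h₀'
        simp at h₀'
      have hGa := Complex.Gamma_add_one _ hne
      rw [sub_add_cancel] at hparts hGa
      rw [hGa]
      rw [Complex.cpow_sub _ _ hρ0, Complex.cpow_one] at hprev
      field_simp at hprev
      simp only [Nat.cast_zero, zero_mul] at hparts
      linear_combination hprev + ρ * Complex.Gamma (θ - 1) * hparts
  obtain ⟨n, hn⟩ := exists_nat_ge θ.re
  exact hall n θ hθ (by linarith)

/-! ### Transition functions -/

namespace IsTransitionFunction

variable {S : Type*} [DecidableEq S] {q : S → S → ℝ} {P : ℝ → S → S → ℝ}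

theorem le_one (hP : IsTransitionFunction q P) {t : ℝ} (ht : 0 ≤ t) (i j : S) : P t i j ≤ 1 :=
  le_hasSum (hP.hasSum_one t ht i) j fun k _ => hP.nonneg t ht i k

theorem norm_le_one (hP : IsTransitionFunction q P) {t : ℝ} (ht : 0 ≤ t) (i j : S) :
    ‖P t i j‖ ≤ 1 := by
  rw [Real.norm_of_nonneg (hP.nonneg t ht i j)]
  exact hP.le_one ht i j

/-- The Chapman-Kolmogorov sum is approximated by its restriction to a finite set. -/
theorem sub_sum_mem_Icc (hP : IsTransitionFunction q P) {s t : ℝ} (hs : 0 ≤ s) (ht : 0 ≤ t)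
    (i j : S) (T : Finset S) :
    P (s + t) i j - ∑ k ∈ T, P s i k * P t k j ∈ Icc 0 (1 - ∑ k ∈ T, P s i k) := by
  have hck := hP.chapman_kolmogorov s t hs ht i j
  refine ⟨sub_nonneg.2 (sum_le_hasSum T (fun k _ => mul_nonneg (hP.nonneg s hs i k)
    (hP.nonneg t ht k j)) hck), ?_⟩
  have hsub := (hP.hasSum_one s hs i).sub hck
  have := sum_le_hasSum T (fun k _ => sub_nonneg.2
    (mul_le_of_le_one_right (hP.nonneg s hs i k) (hP.le_one ht k j))) hsub
  rw [Finset.sum_sub_distrib] at this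
  linarith

theorem abs_sub_le (hP : IsTransitionFunction q P) {s t : ℝ} (hs : 0 ≤ s) (ht : 0 ≤ t) (i j : S) :
    |P (s + t) i j - P t i j| ≤ 1 - P s i i := by
  have h := hP.sub_sum_mem_Icc hs ht i j {i}
  simp only [Finset.sum_singleton] at h
  have h1 := hP.le_one hs i i
  have h2 := hP.le_one ht i j
  have h3 := hP.nonneg t ht i j
  rw [abs_le]
  constructor <;> nlinarith [h.1, h.2]

/-- The increment over a step `s` is at most `1 - P s i i`, uniformly in time, so continuity at time
`0` suffices. -/
theorem continuousOn (hP : IsTransitionFunction q P) (i j : S) :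
    ContinuousOn (fun t => P t i j) (Ici 0) := by
  intro t ht
  have hlim : Tendsto (fun s => 1 - P |s - t| i i) (𝓝[Ici 0] t) (𝓝 0) := by
    have h0 : Tendsto (fun s => P s i i) (𝓝[Ici 0] 0) (𝓝 1) := by
      have := (hP.rates i i).continuousWithinAt.tendsto
      simpa [hP.zero] using this
    have h1 : Tendsto (fun s => |s - t|) (𝓝[Ici 0] t) (𝓝[Ici 0] 0) := by
      refine tendsto_nhdsWithin_iff.2 ⟨?_, Eventually.of_forall fun s => abs_nonneg (s - t)⟩
      have : Continuous fun s : ℝ => |s - t| := by fun_prop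
      simpa using (this.tendsto t).mono_left nhdsWithin_le_nhds
    simpa using (h0.comp h1).const_sub 1
  rw [ContinuousWithinAt, tendsto_iff_norm_sub_tendsto_zero]
  refine squeeze_zero' (Eventually.of_forall fun s => norm_nonneg _) ?_ hlim
  filter_upwards [self_mem_nhdsWithin] with s hs
  rw [Real.norm_eq_abs]
  rcases le_total t s with h | h
  · have := hP.abs_sub_le (sub_nonneg.2 h) (mem_Ici.1 ht) i j
    rwa [sub_add_cancel, ← abs_of_nonneg (sub_nonneg.2 h)] at this
  · have := hP.abs_sub_le (sub_nonneg.2 h) (mem_Ici.1 hs) i j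
    rwa [sub_add_cancel, ← abs_of_nonneg (sub_nonneg.2 h), abs_sub_comm t s, abs_sub_comm] at this

/-- Kolmogorov's backward equation for a row of rates with finite support and zero sum. -/
theorem hasDerivWithinAt (hP : IsTransitionFunction q P) {i : S} {T : Finset S} (hi : i ∈ T)
    (hT : ∑ k ∈ T, q i k = 0) (j : S) {t : ℝ} (ht : 0 ≤ t) :
    HasDerivWithinAt (fun t => P t i j) (∑ k ∈ T, q i k * P t k j) (Ici t) t := by
  have hmain : HasDerivWithinAt (fun s => ∑ k ∈ T, P s i k * P t k j)
      (∑ k ∈ T, q i k * P t k j) (Ici 0) 0 :=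
    HasDerivWithinAt.fun_sum fun k _ => (hP.rates i k).mul_const (P t k j)
  -- The mass that has left `T` by time `s` is `o(s)` because the rates sum to zero over `T`; it
  -- dominates the truncation error of Chapman-Kolmogorov.
  have hdef : HasDerivWithinAt (fun s => 1 - ∑ k ∈ T, P s i k) 0 (Ici 0) 0 := by
    have := (HasDerivWithinAt.fun_sum fun k (_ : k ∈ T) => hP.rates i k).const_sub 1
    rwa [hT, neg_zero] at this
  have hzero : ∀ x : S → ℝ, ∑ k ∈ T, P 0 i k * x k = x i := fun x => by
    simp [hP.zero, hi]
  have hone : ∑ k ∈ T, P 0 i k = 1 := by simpa using hzero fun _ => 1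
  have hrem : HasDerivWithinAt (fun s => P (s + t) i j - ∑ k ∈ T, P s i k * P t k j) 0
      (Ici 0) 0 := by
    rw [hasDerivWithinAt_iff_isLittleO] at hdef ⊢
    refine Asymptotics.IsBigO.trans_isLittleO (Asymptotics.IsBigO.of_bound 1 ?_) hdef
    filter_upwards [self_mem_nhdsWithin] with s hs
    have h := hP.sub_sum_mem_Icc (mem_Ici.1 hs) ht i j T
    simp only [hzero fun k => P t k j, hone, zero_add, sub_self, sub_zero, smul_zero, one_mul]
    rw [Real.norm_of_nonneg h.1, Real.norm_of_nonneg (h.1.trans h.2)]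
    exact h.2
  have hall := hmain.add hrem
  have hall' : HasDerivWithinAt (fun s => P (s + t) i j) (∑ k ∈ T, q i k * P t k j) (Ici 0)
      (t - t) := by
    rw [sub_self]
    exact (hall.congr_deriv (add_zero _)).congr (fun s _ => by simp) (by simp)
  have hshift : HasDerivWithinAt (fun s : ℝ => s - t) 1 (Ici t) t :=
    ((hasDerivAt_id t).sub_const t).hasDerivWithinAt
  have := HasDerivWithinAt.scomp (h := fun s : ℝ => s - t) t hall' hshift (fun s hs => sub_nonneg.2 (mem_Ici.1 hs))
  rw [one_smul] at this
  refine this.congr (fun s _ => ?_) ?_ <;> simp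

theorem laplaceIntegrable (hP : IsTransitionFunction q P) (i j : S) {θ : ℂ} (hθ : 0 < θ.re) :
    LaplaceIntegrable (fun t => P t i j) θ := by
  have hexp : IntegrableOn (fun t : ℝ => Complex.exp (-θ * t)) (Ioi 0) :=
    integrableOn_exp_mul_complex_Ioi (by simpa using hθ) 0
  refine Integrable.mul_bdd (c := 1) hexp ?_ ?_
  · exact (Complex.continuous_ofReal.comp_continuousOn
      ((hP.continuousOn i j).mono Ioi_subset_Ici_self)).aestronglyMeasurable measurableSet_Ioi
  · refine (ae_restrict_mem measurableSet_Ioi).mono fun t ht => ?_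
    rw [Complex.norm_real]
    exact hP.norm_le_one (mem_Ioi.1 ht).le i j

theorem norm_laplaceTransform_le (hP : IsTransitionFunction q P) (i j : S) {θ : ℂ}
    (hθ : 0 < θ.re) : ‖laplaceTransform (fun t => P t i j) θ‖ ≤ 1 / θ.re := by
  have hb : IntegrableOn (fun t : ℝ => Real.exp (-θ.re * t)) (Ioi 0) :=
    integrableOn_exp_mul_Ioi (by simpa using hθ) 0
  refine (norm_integral_le_of_norm_le hb ?_).trans_eq ?_
  · refine (ae_restrict_mem measurableSet_Ioi).mono fun t ht => ?_
    rw [norm_mul, Complex.norm_exp, Complex.norm_real]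
    simp only [Complex.mul_re, Complex.neg_re, Complex.ofReal_re, Complex.ofReal_im, mul_zero,
      sub_zero]
    exact mul_le_of_le_one_right (Real.exp_pos _).le (hP.norm_le_one (mem_Ioi.1 ht).le i j)
  · rw [integral_exp_mul_Ioi (by simpa using hθ)]
    simp

/-- The Laplace transform of Kolmogorov's backward equation. -/
theorem laplaceTransform_eq (hP : IsTransitionFunction q P) {i : S} {T : Finset S} (hi : i ∈ T)
    (hT : ∑ k ∈ T, q i k = 0) (j : S) {θ : ℂ} (hθ : 0 < θ.re) :
    θ * laplaceTransform (fun t => P t i j) θ - (if i = j then 1 else 0) =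
      ∑ k ∈ T, (q i k : ℂ) * laplaceTransform (fun t => P t k j) θ := by
  have hint : ∀ k, IntegrableOn (fun t : ℝ => Complex.exp (-θ * t) * (P t k j : ℂ)) (Ioi 0) :=
    fun k => hP.laplaceIntegrable k j hθ
  set f : ℝ → ℂ := fun t => Complex.exp (-θ * t) * (P t i j : ℂ) with hf
  set f' : ℝ → ℂ := fun t => ∑ k ∈ T, (q i k : ℂ) * (Complex.exp (-θ * t) * (P t k j : ℂ)) -
    θ * (Complex.exp (-θ * t) * (P t i j : ℂ)) with hf'
  have hsum : IntegrableOn (fun t : ℝ => ∑ k ∈ T, (q i k : ℂ) *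
      (Complex.exp (-θ * t) * (P t k j : ℂ))) (Ioi 0) :=
    integrable_finsetSum _ fun k _ => (hint k).const_mul _
  have hf'int : IntegrableOn f' (Ioi 0) := Integrable.sub hsum ((hint i).const_mul θ)
  have hcont : ContinuousOn f (Ici 0) :=
    ContinuousOn.mul (by fun_prop) (Complex.continuous_ofReal.comp_continuousOn
      (hP.continuousOn i j))
  have hder : ∀ t, 0 ≤ t → HasDerivWithinAt f (f' t) (Ici t) t := fun t ht => by
    have h1 : HasDerivAt (fun t : ℝ => Complex.exp (-θ * t)) (Complex.exp (-θ * t) * (-θ * 1)) t :=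
      (Complex.ofRealCLM.hasDerivAt.const_mul (-θ)).cexp
    have h2 := (hP.hasDerivWithinAt hi hT j ht).ofReal_comp
    refine (h1.hasDerivWithinAt.mul h2).congr_deriv ?_
    simp only [hf']
    push_cast
    rw [Finset.mul_sum]
    have : ∀ k ∈ T, (q i k : ℂ) * (Complex.exp (-θ * t) * (P t k j : ℂ)) =
        Complex.exp (-θ * t) * ((q i k : ℂ) * (P t k j : ℂ)) := fun k _ => by ring
    rw [Finset.sum_congr rfl this]
    ring
  -- The backward equation yields right derivatives only; together with continuity these suffice for
  -- the fundamental theorem.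
  have hftc : ∀ X : ℝ, 0 ≤ X → ∫ t in (0 : ℝ)..X, f' t = f X - f 0 := fun X hX =>
    intervalIntegral.integral_eq_sub_of_hasDeriv_right_of_le hX
      (hcont.mono Icc_subset_Ici_self)
      (fun t ht => (hder t ht.1.le).mono Ioi_subset_Ici_self)
      ((intervalIntegrable_iff_integrableOn_Ioc_of_le hX).2 (hf'int.mono_set Ioc_subset_Ioi_self))
  have hlim0 : Tendsto f atTop (𝓝 0) := by
    refine squeeze_zero_norm' (a := fun t => Real.exp (-(θ.re * t))) ?_
      (Real.tendsto_exp_neg_atTop_nhds_zero.comp (tendsto_id.const_mul_atTop hθ))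
    filter_upwards [eventually_ge_atTop 0] with t ht
    rw [hf, norm_mul, Complex.norm_exp, Complex.norm_real]
    simp only [Complex.mul_re, Complex.neg_re, Complex.ofReal_re, Complex.ofReal_im, mul_zero,
      sub_zero, neg_mul]
    exact mul_le_of_le_one_right (Real.exp_pos _).le (hP.norm_le_one ht i j)
  have hlim := intervalIntegral_tendsto_integral_Ioi 0 hf'int tendsto_id
  have hval : ∫ t in Ioi (0 : ℝ), f' t = 0 - f 0 := by
    refine tendsto_nhds_unique hlim ((hlim0.sub_const (f 0)).congr' ?_)
    filter_upwards [eventually_ge_atTop 0] with X hX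
    exact (hftc X hX).symm
  have hf0 : f 0 = if i = j then 1 else 0 := by
    by_cases hij : i = j <;> simp [hf, hP.zero, hij]
  rw [hf', integral_sub hsum ((hint i).const_mul θ),
    integral_finsetSum _ fun k _ => (hint k).const_mul _, integral_const_mul, hf0] at hval
  simp only [integral_const_mul] at hval
  simp only [laplaceTransform]
  linear_combination -hval

end IsTransitionFunction

/-- The transient probabilities of a Markov chain are given by a transition function. -/
theorem IsMarkovChain.transientProb_eq {S Ω : Type*} [DecidableEq S] [MeasurableSpace S]
    [MeasurableSingletonClass S] [MeasurableSpace Ω] {q : S → S → ℝ} {μ : Measure Ω}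
    [IsProbabilityMeasure μ] {N : ℝ → Ω → S} (h : IsMarkovChain q μ N) :
    ∃ P, IsTransitionFunction q P ∧ ∀ i, μ (N 0 ⁻¹' {i}) ≠ 0 → ∀ j t, 0 ≤ t →
      transientProb μ N i j t = P t i j := by
  obtain ⟨hN, P, hP, hfd⟩ := h
  refine ⟨P, hP, fun i hi j t ht => ?_⟩
  have h := hfd 1 ![0, t] ![i, j] le_rfl (by
    intro a b hab
    fin_cases a <;> fin_cases b <;> simp_all)
  have hset : {ω | ∀ a : Fin 2, N (![0, t] a) ω = ![i, j] a} = N 0 ⁻¹' {i} ∩ N t ⁻¹' {j} := by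
    ext ω
    simp [Fin.forall_fin_two]
  rw [hset] at h
  simp only [Fin.prod_univ_one] at h
  have hi' : μ.real (N 0 ⁻¹' {i}) ≠ 0 := by
    rw [Measure.real, ENNReal.toReal_ne_zero]
    exact ⟨hi, measure_ne_top _ _⟩
  have h0 : {ω | N (![0, t] 0) ω = ![i, j] 0} = N 0 ⁻¹' {i} := rfl
  rw [h0] at h
  rw [transientProb, measureReal_def, cond_apply (hN 0 le_rfl (measurableSet_singleton i)),
    ENNReal.toReal_mul, ENNReal.toReal_inv, ← measureReal_def, ← measureReal_def, h]
  simp [hi']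

theorem laplaceTransform_congr {f g : ℝ → ℝ} (h : ∀ t, 0 ≤ t → f t = g t) (θ : ℂ) :
    laplaceTransform f θ = laplaceTransform g θ :=
  setIntegral_congr_fun measurableSet_Ioi fun t ht => by
    simp only [h t (mem_Ioi.1 ht).le]

theorem laplaceIntegrable_congr {f g : ℝ → ℝ} (h : ∀ t, 0 ≤ t → f t = g t) (θ : ℂ) :
    LaplaceIntegrable f θ ↔ LaplaceIntegrable g θ :=
  integrableOn_congr_fun (fun t ht => by simp only [h t (mem_Ioi.1 ht).le]) measurableSet_Ioi

/-- A row of the generator of a birth-death process, applied to a function. -/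
theorem sum_birthDeathRate_mul {b d : ℕ → ℝ} (hd : d 0 = 0) {i M : ℕ} (hi : i < M)
    (hM : i + 1 < M ∨ b i = 0) (x : ℕ → ℂ) :
    ∑ k ∈ Finset.range M, (birthDeathRate b d i k : ℂ) * x k =
      b i * (x (i + 1) - x i) + d i * (x (i - 1) - x i) := by
  -- At `i = 0` the truncated `i - 1` is `i` itself; the extra term is harmless because `d 0 = 0`.
  have hrow : ∀ k, (birthDeathRate b d i k : ℂ) * x k = (if k = i + 1 then b i * x k else 0) +
      (if k = i - 1 then d i * x k else 0) - (if k = i then (b i + d i) * x k else 0) := by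
    intro k
    rcases Nat.eq_zero_or_pos i with rfl | hpos
    · by_cases h1 : k = 1
      · simp [birthDeathRate, h1]
      · by_cases h0 : k = 0
        · simp [birthDeathRate, h0, hd]
        · simp [birthDeathRate, h0, h1, Ne.symm h0]
    · by_cases h1 : k = i + 1
      · have h2 : k ≠ i - 1 := by omega
        have h3 : k ≠ i := by omega
        simp [birthDeathRate, h1]
        omega
      · by_cases h2 : k = i - 1
        · have h3 : i = k + 1 := by omega
          have h4 : k ≠ i := by omega
          have h5 : k ≠ k + 1 + 1 := by omega
          simp [birthDeathRate, h3, h5]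
        · have h3 : ¬ i = k + 1 := by omega
          by_cases h4 : k = i
          · subst h4
            simp [birthDeathRate, h2]
            ring
          · simp [birthDeathRate, h1, h2, h3, h4, Ne.symm h4]
  simp only [hrow, Finset.sum_sub_distrib, Finset.sum_add_distrib, Finset.sum_ite_eq',
    Finset.mem_range, hi, if_true, show i - 1 < M by omega]
  rcases hM with hM | hM
  · simp only [hM, if_true]
    ring
  · simp only [hM]
    simp
    ring

theorem sum_birthDeathRate {b d : ℕ → ℝ} (hd : d 0 = 0) {i M : ℕ} (hi : i < M)
    (hM : i + 1 < M ∨ b i = 0) : ∑ k ∈ Finset.range M, birthDeathRate b d i k = 0 := by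
  have := sum_birthDeathRate_mul hd hi hM fun _ => 1
  simp only [mul_one, sub_self, mul_zero, add_zero] at this
  exact_mod_cast this

/-! ### Recurrence and Wronskian for the `G_n` -/

theorem G_eq_kernelG (ε R ρ : ℝ) (n : ℕ) (θ : ℂ) : G ε R ρ n θ =
    (2 * (Real.pi : ℂ) * Complex.I)⁻¹ * hankelIntegral ε R (kernelG ρ (n + 1) θ) := rfl

/-- The elimination of `θ + 1` as for `F`. The case `k = 0`, which would involve `G_{-1}`, is what
the Wronskian requires. -/
theorem hankelIntegral_kernelG_recurrence {ε R ρ : ℝ} (hε : 0 < ε) (hR : 1 < R) (hρ : 0 < ρ) (k : ℕ)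
    {θ : ℂ} (hθ : 0 ≤ θ.re) :
    ((k : ℂ) + 1) * hankelIntegral ε R (kernelG ρ (k + 2) θ) =
      (ρ + k + θ) * hankelIntegral ε R (kernelG ρ (k + 1) θ) -
        ρ * hankelIntegral ε R (kernelG ρ k θ) := by
  have h1 := hankelIntegral_kernelG_succ hε hR hρ k hθ
  have h2 := hankelIntegral_kernelG_succ hε hR hρ (k + 1) hθ
  have h3 := hankelIntegral_kernelG_add_one hε hR hρ k hθ
  push_cast at h2
  linear_combination h2 - h1 + θ * h3

theorem G_recurrence {ε R ρ : ℝ} (hε : 0 < ε) (hR : 1 < R) (hρ : 0 < ρ) (n : ℕ)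
    {θ : ℂ} (hθ : 0 ≤ θ.re) :
    ((n : ℂ) + 2) * G ε R ρ (n + 2) θ =
      (ρ + n + 1 + θ) * G ε R ρ (n + 1) θ - ρ * G ε R ρ n θ := by
  have h := hankelIntegral_kernelG_recurrence hε hR hρ (n + 1) hθ
  push_cast at h
  simp only [G_eq_kernelG]
  linear_combination (2 * (Real.pi : ℂ) * Complex.I)⁻¹ * h

/-- As `F_0 = 1` and `F_1 = ρ + θ`, the recurrence at `k = 0` reduces the Wronskian to `ρ` times the
integral without a power of `z`, which is Hankel's. -/
theorem wronskian_zero {r ε R ρ : ℝ} (hr₀ : 0 < r) (hr₁ : r < 1) (hε : 0 < ε) (hR : 1 < R)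
    (hρ : 0 < ρ) {θ : ℂ} (hθ : 0 < θ.re) :
    Complex.Gamma θ * (F r ρ 1 θ * G ε R ρ 0 θ - F r ρ 0 θ * G ε R ρ 1 θ) =
      Complex.exp ρ * (ρ : ℂ) ^ θ := by
  have h1 := hankelIntegral_kernelG_recurrence hε hR hρ 0 hθ.le
  have h2 := Gamma_mul_hankelIntegral hε hR hρ hθ
  have h3 := inv_mul_cancel₀ Complex.two_pi_I_ne_zero
  rw [F_one hr₀ hr₁, F_zero hr₀ hr₁, G_eq_kernelG, G_eq_kernelG]
  push_cast at h1
  linear_combination (2 * (Real.pi : ℂ) * Complex.I)⁻¹ * h2 -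
    Complex.Gamma θ * (2 * (Real.pi : ℂ) * Complex.I)⁻¹ * h1 +
    (Complex.exp ρ * (ρ : ℂ) ^ θ) * h3

/-! ### The resolvent of a birth-death generator with rates `ρ` and `n` -/

/-- Two solutions of the three-term recurrence of the `F_n`, the first one regular at the origin,
with normalised Wronskian `ρ ^ n / n!`. -/
structure IsSolutionPair (ρ θ C : ℂ) (f y : ℕ → ℂ) : Prop where
  ne_zero : ρ ≠ 0
  left_zero : f 0 = 1
  left_one : f 1 = ρ + θ
  left : ∀ n : ℕ, ((n : ℂ) + 2) * f (n + 2) = (ρ + n + 1 + θ) * f (n + 1) - ρ * f n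
  right : ∀ n : ℕ, ((n : ℂ) + 2) * y (n + 2) = (ρ + n + 1 + θ) * y (n + 1) - ρ * y n
  wronskian : C * (f 1 * y 0 - f 0 * y 1) = 1

/-- The Green function of a solution pair. -/
def green (ρ C : ℂ) (f y : ℕ → ℂ) (i j : ℕ) : ℂ :=
  C * (i.factorial / ρ ^ i) * if i ≤ j then f i * y j else f j * y i

/-- The weight `n!/ρ^n`, the inverse of the reversing measure, turns the recurrence into the
homogeneous backward equation. -/
theorem backward_of_recurrence {ρ θ : ℂ} (hρ : ρ ≠ 0) {s : ℕ → ℂ} {n : ℕ}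
    (hs : ((n : ℂ) + 2) * s (n + 2) = (ρ + n + 1 + θ) * s (n + 1) - ρ * s n) :
    θ * ((n + 1).factorial / ρ ^ (n + 1) * s (n + 1)) =
      ρ * ((n + 2).factorial / ρ ^ (n + 2) * s (n + 2) -
        (n + 1).factorial / ρ ^ (n + 1) * s (n + 1)) +
      (n + 1) * (n.factorial / ρ ^ n * s n - (n + 1).factorial / ρ ^ (n + 1) * s (n + 1)) := by
  have h2 : ((n + 2).factorial : ℂ) / ρ ^ (n + 2) * s (n + 2) =
      (n + 1).factorial / ρ ^ (n + 2) * (((n : ℂ) + 2) * s (n + 2)) := by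
    rw [Nat.factorial_succ (n + 1)]
    push_cast
    ring
  rw [h2, hs, Nat.factorial_succ n]
  push_cast
  field_simp
  ring

namespace IsSolutionPair

variable {ρ θ C : ℂ} {f y : ℕ → ℂ}

/-- Discrete Abel identity: each step of the recurrence multiplies the Wronskian by a known factor.
-/
theorem wronskian_eq (h : IsSolutionPair ρ θ C f y) (n : ℕ) :
    C * (n.factorial * (((n : ℂ) + 1) * (f (n + 1) * y n - f n * y (n + 1)))) = ρ ^ n := by
  induction n with
  | zero => simpa using h.wronskian
  | succ n ih =>
    have h1 := h.left n
    have h2 := h.right n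
    rw [Nat.factorial_succ]
    push_cast
    linear_combination ρ * ih + C * n.factorial * ((n : ℂ) + 1) * (y (n + 1) * h1 - f (n + 1) * h2)

theorem backward_left (h : IsSolutionPair ρ θ C f y) (i : ℕ) :
    θ * (i.factorial / ρ ^ i * f i) =
      ρ * ((i + 1).factorial / ρ ^ (i + 1) * f (i + 1) - i.factorial / ρ ^ i * f i) +
      i * ((i - 1).factorial / ρ ^ (i - 1) * f (i - 1) - i.factorial / ρ ^ i * f i) := by
  have hρ := h.ne_zero
  cases i with
  | zero =>
    simp [h.left_zero, h.left_one]
    field_simp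
    ring
  | succ n => simpa using backward_of_recurrence hρ (h.left n)

/-- Off the diagonal the Green function is a multiple of one homogeneous solution; on it, the
mismatch between the two branches is the Wronskian, which produces the unit source. -/
theorem backward_green (h : IsSolutionPair ρ θ C f y) (i j : ℕ) :
    θ * green ρ C f y i j - (if i = j then 1 else 0) =
      ρ * (green ρ C f y (i + 1) j - green ρ C f y i j) +
      i * (green ρ C f y (i - 1) j - green ρ C f y i j) := by
  have hρ := h.ne_zero
  rcases lt_trichotomy i j with hij | rfl | hij
  · have h1 : i + 1 ≤ j := hij
    have h2 : i - 1 ≤ j := by omega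
    simp only [green, h1, h2, hij.le, hij.ne, if_true, if_false]
    linear_combination C * y j * h.backward_left i
  · have hw := h.wronskian_eq i
    have hb := h.backward_left i
    have h2 : i - 1 ≤ i := by omega
    have hf : ((i + 1).factorial : ℂ) = i.factorial * (i + 1) := by
      rw [Nat.factorial_succ]
      push_cast
      ring
    have hw' : C * (ρ * ((i + 1).factorial / ρ ^ (i + 1))) * (f (i + 1) * y i - f i * y (i + 1)) =
        1 := by
      rw [hf, pow_succ]
      field_simp
      linear_combination hw
    simp only [green, h2, le_refl, if_true, show ¬ i + 1 ≤ i by omega, if_false]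
    linear_combination C * y i * hb + hw'
  · obtain ⟨n, rfl⟩ : ∃ n, i = n + 1 := ⟨i - 1, by omega⟩
    have hb := backward_of_recurrence hρ (h.right n)
    -- For `n = j` the definition takes the other branch, but the two agree there.
    have hn : green ρ C f y n j = C * (n.factorial / ρ ^ n) * (f j * y n) := by
      rcases (Nat.lt_succ_iff.1 hij).eq_or_lt with rfl | hlt
      · simp [green]
      · simp [green, hlt.not_ge]
    rw [Nat.add_sub_cancel, hn]
    simp only [green, show ¬ n + 1 ≤ j by omega, show ¬ n + 1 + 1 ≤ j by omega, hij.ne', if_false]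
    push_cast
    linear_combination C * f j * hb

theorem green_succ_eq (h : IsSolutionPair ρ θ C f y) {m : ℕ}
    (hm : ((m : ℂ) + 1) * y (m + 1) = ρ * y m) {j : ℕ} (hj : j ≤ m) :
    green ρ C f y (m + 1) j = green ρ C f y m j := by
  have hρ := h.ne_zero
  have hg : green ρ C f y m j = C * (m.factorial / ρ ^ m) * (f j * y m) := by
    rcases hj.eq_or_lt with rfl | hlt
    · simp [green]
    · simp [green, hlt.not_ge]
  rw [hg, green, if_neg (by omega), Nat.factorial_succ]
  push_cast
  field_simp
  linear_combination C * m.factorial * f j * ρ ^ m * hm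

/-- Row `0` has no lower neighbour and `ρ ≠ 0`, so the rows determine a homogeneous solution
successively from its value at `0`. -/
theorem eq_mul_of_backward (h : IsSolutionPair ρ θ C f y) {w : ℕ → ℂ} {m : ℕ}
    (hw : ∀ i ≤ m, θ * w i = ρ * (w (i + 1) - w i) + i * (w (i - 1) - w i)) :
    ∀ i ≤ m + 1, w i = w 0 * (i.factorial / ρ ^ i * f i) := by
  intro i
  induction i using Nat.strong_induction_on with
  | _ i ih =>
    intro hi
    cases i with
    | zero => simp [h.left_zero]
    | succ n =>
      have h1 := hw n (by omega)
      have h2 := h.backward_left n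
      have h3 := ih n (by omega) (by omega)
      have h4 := ih (n - 1) (by omega) (by omega)
      rw [h3, h4] at h1
      refine mul_left_cancel₀ h.ne_zero ?_
      linear_combination w 0 * h2 - h1

/-- A function that satisfies the resolvent equation of the birth-death generator up to the
boundary is the Green function up to a multiple of the jump at the boundary. -/
theorem eq_green_add (h : IsSolutionPair ρ θ C f y) {m : ℕ}
    (hm : ((m : ℂ) + 1) * y (m + 1) = ρ * y m) {j : ℕ} (hj : j ≤ m)
    (hD : ((m : ℂ) + 1) * f (m + 1) - ρ * f m ≠ 0) {u : ℕ → ℂ}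
    (hu : ∀ i ≤ m, θ * u i - (if i = j then 1 else 0) =
      ρ * (u (i + 1) - u i) + i * (u (i - 1) - u i)) {i : ℕ} (hi : i ≤ m) :
    u i = green ρ C f y i j + (u (m + 1) - u m) * (ρ ^ (m + 1) / m.factorial /
      (((m : ℂ) + 1) * f (m + 1) - ρ * f m) * (i.factorial / ρ ^ i * f i)) := by
  have hρ := h.ne_zero
  have hw := h.eq_mul_of_backward (w := fun i => u i - green ρ C f y i j) (m := m) fun i hi => by
    linear_combination hu i hi - h.backward_green i j
  have h0 := hw i (by omega)
  have h1 := hw m (by omega)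
  have h2 := hw (m + 1) le_rfl
  rw [h.green_succ_eq hm hj] at h2
  set w₀ := u 0 - green ρ C f y 0 j
  have hf : (m.factorial : ℂ) ≠ 0 := by exact_mod_cast m.factorial_ne_zero
  -- The Green function has no jump at `m`, so the jump of `u` is that of the regular solution; by
  -- `hD` it determines the coefficient `w₀`.
  have hjump : u (m + 1) - u m =
      w₀ * (m.factorial / ρ ^ (m + 1) * (((m : ℂ) + 1) * f (m + 1) - ρ * f m)) := by
    have : ((m + 1).factorial / ρ ^ (m + 1) * f (m + 1) - m.factorial / ρ ^ m * f m : ℂ) =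
        m.factorial / ρ ^ (m + 1) * (((m : ℂ) + 1) * f (m + 1) - ρ * f m) := by
      rw [Nat.factorial_succ, pow_succ]
      push_cast
      field_simp
    rw [← this]
    linear_combination h2 - h1
  have hw₀ : (u (m + 1) - u m) * (ρ ^ (m + 1) / m.factorial /
      (((m : ℂ) + 1) * f (m + 1) - ρ * f m)) = w₀ := by
    rw [hjump]
    field_simp
  rw [← mul_assoc, hw₀]
  linear_combination h0

/-- The boundary condition eliminates `y (m + 1)` from the Wronskian at `m`, which then determines
`C * y m`. -/
theorem green_boundary (h : IsSolutionPair ρ θ C f y) {m : ℕ}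
    (hm : ((m : ℂ) + 1) * y (m + 1) = ρ * y m) {i : ℕ} (hi : i ≤ m)
    (hD : ((m : ℂ) + 1) * f (m + 1) - ρ * f m ≠ 0) :
    green ρ C f y i m = i.factorial / m.factorial * ρ ^ (m - i) *
      (f i / (((m : ℂ) + 1) * f (m + 1) - ρ * f m)) := by
  have hρ := h.ne_zero
  have hw := h.wronskian_eq m
  have hf : (m.factorial : ℂ) ≠ 0 := by exact_mod_cast m.factorial_ne_zero
  have hy : C * y m = ρ ^ m / m.factorial / (((m : ℂ) + 1) * f (m + 1) - ρ * f m) := by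
    rw [div_div, eq_div_iff (mul_ne_zero hf hD)]
    linear_combination hw + C * m.factorial * f m * hm
  have hpow : ρ ^ m = ρ ^ (m - i) * ρ ^ i := by rw [← pow_add, Nat.sub_add_cancel hi]
  rw [green, if_pos hi, show C * (i.factorial / ρ ^ i) * (f i * y m) =
    (i.factorial / ρ ^ i) * f i * (C * y m) by ring, hy, hpow]
  field_simp

end IsSolutionPair

/-! ### The solution pair `F_n` and `G_n + ω F_n` -/

theorem boundary_eq {r ε R ρ : ℝ} (hr₀ : 0 < r) (hr₁ : r < 1) (hρ : 0 < ρ) (m : ℕ) {θ : ℂ}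
    (hθ : 0 < θ.re) :
    ((m : ℂ) + 1) * (G ε R ρ (m + 1) θ + omega r ε R ρ m θ * F r ρ (m + 1) θ) =
      ρ * (G ε R ρ m θ + omega r ε R ρ m θ * F r ρ m θ) := by
  have hD : (ρ : ℂ) * F r ρ m θ - ((m : ℂ) + 1) * F r ρ (m + 1) θ ≠ 0 := by
    rw [← neg_sub, neg_ne_zero]
    exact F_denominator_ne_zero hr₀ hr₁ hρ m hθ
  have h : omega r ε R ρ m θ * ((ρ : ℂ) * F r ρ m θ - ((m : ℂ) + 1) * F r ρ (m + 1) θ) =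
      ((m : ℂ) + 1) * G ε R ρ (m + 1) θ - ρ * G ε R ρ m θ := div_mul_cancel₀ _ hD
  linear_combination -h

/-- Adding a multiple of `F` to `G` leaves the Wronskian unchanged; the constant is the inverse of
its value. -/
theorem isSolutionPair {r ε R ρ : ℝ} (hr₀ : 0 < r) (hr₁ : r < 1) (hε : 0 < ε) (hR : 1 < R)
    (hρ : 0 < ρ) (m : ℕ) {θ : ℂ} (hθ : 0 < θ.re) :
    IsSolutionPair ρ θ (Complex.Gamma θ * Complex.exp (-(ρ : ℂ)) / (ρ : ℂ) ^ θ)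
      (fun n => F r ρ n θ) (fun n => G ε R ρ n θ + omega r ε R ρ m θ * F r ρ n θ) where
  ne_zero := by exact_mod_cast hρ.ne'
  left_zero := F_zero hr₀ hr₁ ρ θ
  left_one := F_one hr₀ hr₁ ρ θ
  left n := F_recurrence hr₀ hr₁ ρ n θ
  right n := by
    linear_combination G_recurrence hε hR hρ n hθ.le +
      omega r ε R ρ m θ * F_recurrence hr₀ hr₁ ρ n θ
  wronskian := by
    have hρ0 : (ρ : ℂ) ≠ 0 := by exact_mod_cast hρ.ne'
    have hp : (ρ : ℂ) ^ θ ≠ 0 := by simp [Complex.cpow_eq_zero_iff, hρ0]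
    have he : Complex.exp (ρ : ℂ) ≠ 0 := Complex.exp_ne_zero _
    have h := wronskian_zero hr₀ hr₁ hε hR hρ hθ
    rw [Complex.exp_neg]
    field_simp
    linear_combination h

/-! ### Resolvent equations of the two queues -/

namespace IsTransitionFunction

theorem laplaceTransform_birthDeath_eq {b d : ℕ → ℝ} (hd : d 0 = 0) {P : ℝ → ℕ → ℕ → ℝ}
    (hP : IsTransitionFunction (birthDeathRate b d) P) (i j : ℕ) {θ : ℂ} (hθ : 0 < θ.re) :
    θ * laplaceTransform (fun t => P t i j) θ - (if i = j then 1 else 0) =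
      b i * (laplaceTransform (fun t => P t (i + 1) j) θ - laplaceTransform (fun t => P t i j) θ) +
      d i * (laplaceTransform (fun t => P t (i - 1) j) θ -
        laplaceTransform (fun t => P t i j) θ) := by
  rw [hP.laplaceTransform_eq (Finset.mem_range.2 (by omega : i < i + 2))
    (sum_birthDeathRate hd (by omega) (by omega)) j hθ]
  exact sum_birthDeathRate_mul hd (by omega) (by omega)
    fun k => laplaceTransform (fun t => P t k j) θ

theorem laplaceTransform_erlangA_eq {ρ η : ℝ} {m : ℕ} {P : ℝ → ℕ → ℕ → ℝ}
    (hP : IsTransitionFunction (erlangARate ρ m η) P) {i : ℕ} (hi : i ≤ m) (j : ℕ) {θ : ℂ}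
    (hθ : 0 < θ.re) :
    θ * laplaceTransform (fun t => P t i j) θ - (if i = j then 1 else 0) =
      ρ * (laplaceTransform (fun t => P t (i + 1) j) θ - laplaceTransform (fun t => P t i j) θ) +
      i * (laplaceTransform (fun t => P t (i - 1) j) θ -
        laplaceTransform (fun t => P t i j) θ) := by
  have h := laplaceTransform_birthDeath_eq (by simp) hP i j hθ
  simpa only [hi, if_true, Complex.ofReal_natCast] using h

/-- The transforms for the initial states `m` and `m + 1` get close as `η → ∞`. -/
theorem norm_laplaceTransform_succ_sub_le {ρ η : ℝ} (hρ : 0 < ρ) (hη : 0 < η) {m : ℕ}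
    {P : ℝ → ℕ → ℕ → ℝ} (hP : IsTransitionFunction (erlangARate ρ m η) P) {j : ℕ} (hj : j ≤ m)
    {θ : ℂ} (hθ : 0 < θ.re) :
    ‖laplaceTransform (fun t => P t (m + 1) j) θ - laplaceTransform (fun t => P t m j) θ‖ ≤
      (‖θ‖ + 2 * ρ) / θ.re / η := by
  have h := laplaceTransform_birthDeath_eq (by simp) hP (m + 1) j hθ
  have hb := fun i => hP.norm_laplaceTransform_le i j hθ
  simp only [show ¬ m + 1 ≤ m by omega, show m + 1 ≠ j by omega, if_false,
    Nat.add_sub_cancel] at h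
  generalize hu₁ : laplaceTransform (fun t => P t (m + 1) j) θ = u₁ at h ⊢
  generalize hu₀ : laplaceTransform (fun t => P t m j) θ = u₀ at h ⊢
  generalize hu₂ : laplaceTransform (fun t => P t (m + 1 + 1) j) θ = u₂ at h ⊢
  have b₁ : ‖u₁‖ ≤ 1 / θ.re := hu₁ ▸ hb (m + 1)
  have b₂ : ‖u₂‖ ≤ 1 / θ.re := hu₂ ▸ hb (m + 1 + 1)
  -- Row `m + 1` of the backward equation, where the death rate is `m + η`; its right side is
  -- bounded independently of `η`.
  have heq : ((m + η : ℝ) : ℂ) * (u₁ - u₀) = (ρ : ℂ) * (u₂ - u₁) - θ * u₁ := by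
    push_cast at h ⊢
    linear_combination h
  have hnorm := congrArg norm heq
  have hm : (0 : ℝ) ≤ m := m.cast_nonneg
  rw [norm_mul, Complex.norm_real, Real.norm_of_nonneg (by positivity)] at hnorm
  have hle : (m + η) * ‖u₁ - u₀‖ ≤ (‖θ‖ + 2 * ρ) / θ.re := by
    rw [hnorm]
    refine (norm_sub_le _ _).trans ?_
    rw [norm_mul, norm_mul, Complex.norm_real, Real.norm_of_nonneg hρ.le]
    calc ρ * ‖u₂ - u₁‖ + ‖θ‖ * ‖u₁‖ ≤ ρ * (1 / θ.re + 1 / θ.re) + ‖θ‖ * (1 / θ.re) := by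
          gcongr
          exact (norm_sub_le _ _).trans (add_le_add b₂ b₁)
      _ = (‖θ‖ + 2 * ρ) / θ.re := by ring
  rw [le_div_iff₀ hη]
  nlinarith [norm_nonneg (u₁ - u₀)]

/-- The truncation `min k m` extends the transforms to all of `ℕ`, constant beyond `m`. Row `m`,
which has no births, then has the same form as the others because its birth term vanishes. -/
theorem laplaceTransform_erlangLoss_eq {ρ : ℝ} {m : ℕ} {P : ℝ → Fin (m + 1) → Fin (m + 1) → ℝ}
    (hP : IsTransitionFunction (erlangLossRate ρ m) P) {i : ℕ} (hi : i ≤ m) (j : Fin (m + 1))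
    {θ : ℂ} (hθ : 0 < θ.re) :
    θ * laplaceTransform (fun t => P t (Fin.ofNat (m + 1) (min i m)) j) θ -
        (if i = j then 1 else 0) =
      ρ * (laplaceTransform (fun t => P t (Fin.ofNat (m + 1) (min (i + 1) m)) j) θ -
        laplaceTransform (fun t => P t (Fin.ofNat (m + 1) (min i m)) j) θ) +
      i * (laplaceTransform (fun t => P t (Fin.ofNat (m + 1) (min (i - 1) m)) j) θ -
        laplaceTransform (fun t => P t (Fin.ofNat (m + 1) (min i m)) j) θ) := by
  set b : ℕ → ℝ := fun n => if n < m then ρ else 0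
  set d : ℕ → ℝ := fun n => (n : ℝ)
  set u : ℕ → ℂ := fun k => laplaceTransform (fun t => P t (Fin.ofNat (m + 1) (min k m)) j) θ
    with hu
  have hlt : i < m + 1 := Nat.lt_succ_iff.2 hi
  have hbd : i + 1 < m + 1 ∨ b i = 0 := by
    rcases hi.eq_or_lt with rfl | h
    · right
      simp [b]
    · left
      omega
  have hcast : ∀ k : Fin (m + 1), Fin.ofNat (m + 1) (min (k : ℕ) m) = k := fun k => by
    rw [min_eq_left (Nat.lt_succ_iff.1 k.2)]
    exact Fin.ofNat_val_eq_self k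
  have hrow : ∑ k, erlangLossRate ρ m ⟨i, hlt⟩ k = 0 := by
    rw [← sum_birthDeathRate (b := b) (d := d) (by simp [d]) hlt hbd]
    exact Fin.sum_univ_eq_sum_range (fun k => birthDeathRate b d i k) (m + 1)
  have h := hP.laplaceTransform_eq (Finset.mem_univ ⟨i, hlt⟩) hrow j hθ
  have hsum : ∑ k, (erlangLossRate ρ m ⟨i, hlt⟩ k : ℂ) * laplaceTransform (fun t => P t k j) θ =
      ∑ k ∈ Finset.range (m + 1), (birthDeathRate b d i k : ℂ) * u k := by
    rw [← Fin.sum_univ_eq_sum_range (fun k => (birthDeathRate b d i k : ℂ) * u k) (m + 1)]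
    refine Finset.sum_congr rfl fun k _ => ?_
    simp only [hu, hcast]
    rfl
  rw [hsum, sum_birthDeathRate_mul (by simp [d]) hlt hbd] at h
  have hui : laplaceTransform (fun t => P t ⟨i, hlt⟩ j) θ = u i := by
    simp only [hu]
    rw [← hcast ⟨i, hlt⟩]
  have hbu : (b i : ℂ) * (u (i + 1) - u i) = ρ * (u (i + 1) - u i) := by
    rcases hi.eq_or_lt with rfl | h
    · simp [hu]
    · simp [b, h]
  have hdi : (d i : ℂ) = i := by simp [d]
  rw [hui, hbu, hdi] at h
  rw [← h]
  simp only [Fin.ext_iff, hu]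

end IsTransitionFunction

end ErlangQueue

end

/-! ### The limit, its closed forms and the loss model -/

theorem corollary4 (ρ : ℝ) (hρ : 0 < ρ) (m n₀ : ℕ) (hn₀ : n₀ ≤ m) (θ : ℂ) (hθ : 0 < θ.re)
    (r : ℝ) (hr₀ : 0 < r) (hr₁ : r < 1) (ε : ℝ) (hε : 0 < ε) (R : ℝ) (hR : 1 < R) :
    -- the denominators below do not vanish
    ((m : ℂ) + 1) * F r ρ (m + 1) θ - (ρ : ℂ) * F r ρ m θ ≠ 0 ∧
    gammaSum ρ m (θ + 1) ≠ 0 ∧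
    jagermanIntegral ρ m θ ≠ 0 ∧
    ∃ L : ℕ → ℂ,
      -- the limit
      (∀ n, n₀ ≤ n → n ≤ m →
        L n = (n₀.factorial : ℂ) * Complex.Gamma θ * Complex.exp (-(ρ : ℂ)) /
              (ρ : ℂ) ^ ((n₀ : ℂ) + θ) * F r ρ n₀ θ *
            (G ε R ρ n θ +
              omega r ε R ρ m θ * F r ρ n θ)) ∧
      (∀ n, n ≤ n₀ →
        L n = (n₀.factorial : ℂ) * Complex.Gamma θ * Complex.exp (-(ρ : ℂ)) /
              (ρ : ℂ) ^ ((n₀ : ℂ) + θ) * F r ρ n θ *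
            (G ε R ρ n₀ θ +
              omega r ε R ρ m θ * F r ρ n₀ θ)) ∧
      -- the blocking probability
      L m = (n₀.factorial : ℂ) / (m.factorial : ℂ) * (ρ : ℂ) ^ (m - n₀) *
          (F r ρ n₀ θ /
            (((m : ℂ) + 1) * F r ρ (m + 1) θ - (ρ : ℂ) * F r ρ m θ)) ∧
      L m = gammaSum ρ n₀ θ / gammaSum ρ m (θ + 1) ∧
      -- Jagerman's formula
      (n₀ = 0 → L m = Complex.Gamma θ / jagermanIntegral ρ m θ) ∧
      -- `L n` is the limit of the transforms in the Erlang A model as `η → ∞`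
      (∀ (Ω : ℝ → Type*) [∀ η, MeasurableSpace (Ω η)] (μ : ∀ η, Measure (Ω η))
          [∀ η, IsProbabilityMeasure (μ η)] (N : ∀ η, ℝ → Ω η → ℕ),
        (∀ η, 0 < η → IsMarkovChain (erlangARate ρ m η) (μ η) (N η)) →
        (∀ η, 0 < η → μ η (N η 0 ⁻¹' {n₀}) ≠ 0) →
        ∀ n, n ≤ m →
          (∀ η, 0 < η →
            LaplaceIntegrable (transientProb (μ η) (N η) n₀ n) θ) ∧
          Tendsto (fun η : ℝ =>
              laplaceTransform (transientProb (μ η) (N η) n₀ n) θ)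
            atTop (𝓝 (L n))) ∧
      -- `L n` is the transform in the Erlang loss model
      (∀ (Ω : Type*) [MeasurableSpace Ω] (μ : Measure Ω) [IsProbabilityMeasure μ]
          (N : ℝ → Ω → Fin (m + 1)),
        IsMarkovChain (erlangLossRate ρ m) μ N →
        ∀ i₀ : Fin (m + 1), (i₀ : ℕ) = n₀ → μ (N 0 ⁻¹' {i₀}) ≠ 0 →
        ∀ n : Fin (m + 1),
          LaplaceIntegrable (transientProb μ N i₀ n) θ ∧
          laplaceTransform (transientProb μ N i₀ n) θ = L n) := by
  have hpair := isSolutionPair hr₀ hr₁ hε hR hρ m hθ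
  have hbdry := boundary_eq (r := r) (ε := ε) (R := R) hr₀ hr₁ hρ m hθ
  have hD := F_denominator_ne_zero hr₀ hr₁ hρ m hθ
  have hρ0 : (ρ : ℂ) ≠ 0 := by exact_mod_cast hρ.ne'
  have hconst : (n₀.factorial : ℂ) * Complex.Gamma θ * Complex.exp (-(ρ : ℂ)) /
      (ρ : ℂ) ^ ((n₀ : ℂ) + θ) =
      Complex.Gamma θ * Complex.exp (-(ρ : ℂ)) / (ρ : ℂ) ^ θ *
        (n₀.factorial / (ρ : ℂ) ^ n₀) := by
    rw [Complex.cpow_add _ _ hρ0, Complex.cpow_natCast]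
    field_simp
  have hgamma : green ρ (Complex.Gamma θ * Complex.exp (-(ρ : ℂ)) / (ρ : ℂ) ^ θ)
      (fun n => F r ρ n θ) (fun n => G ε R ρ n θ + omega r ε R ρ m θ * F r ρ n θ) n₀ m =
      gammaSum ρ n₀ θ / gammaSum ρ m (θ + 1) := by
    have hG := Complex.Gamma_ne_zero_of_re_pos hθ
    have hS := gammaSum_add_one_ne_zero hρ m hθ
    have hf : (m.factorial : ℂ) ≠ 0 := by exact_mod_cast m.factorial_ne_zero
    have hf₀ : (n₀.factorial : ℂ) ≠ 0 := by exact_mod_cast n₀.factorial_ne_zero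
    have hpow : (ρ : ℂ) ^ m = (ρ : ℂ) ^ (m - n₀) * (ρ : ℂ) ^ n₀ := by
      rw [← pow_add, Nat.sub_add_cancel hn₀]
    rw [hpair.green_boundary hbdry hn₀ hD, F_denominator_eq_gammaSum hr₀ hr₁ hρ.ne' m hθ,
      F_eq_gammaSum hr₀ hr₁ hρ.ne' n₀ hθ, hpow]
    field_simp
  refine ⟨hD, gammaSum_add_one_ne_zero hρ m hθ, ?_, fun n => green ρ
    (Complex.Gamma θ * Complex.exp (-(ρ : ℂ)) / (ρ : ℂ) ^ θ) (fun n => F r ρ n θ)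
    (fun n => G ε R ρ n θ + omega r ε R ρ m θ * F r ρ n θ) n₀ n, ?_, ?_, ?_, hgamma, ?_, ?_, ?_⟩
  · rw [jagermanIntegral_eq_gammaSum ρ m hθ]
    exact gammaSum_add_one_ne_zero hρ m hθ
  · intro n hn _
    beta_reduce
    rw [hconst, green, if_pos hn]
    ring
  · intro n hn
    beta_reduce
    rw [hconst]
    rcases hn.eq_or_lt with rfl | hlt
    · rw [green, if_pos le_rfl]
      ring
    · rw [green, if_neg hlt.not_ge]
      ring
  · exact hpair.green_boundary hbdry hn₀ hD
  · rintro rfl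
    beta_reduce
    rw [hgamma, jagermanIntegral_eq_gammaSum ρ m hθ]
    simp [gammaSum]
  · intro Ω _ μ _ N hN hN₀ n hn
    choose! P hP hPN using fun η (hη : 0 < η) => (hN η hη).transientProb_eq
    have hPn : ∀ η, 0 < η → ∀ t, 0 ≤ t → transientProb (μ η) (N η) n₀ n t = P η t n₀ n :=
      fun η hη => hPN η hη n₀ (hN₀ η hη) n
    refine ⟨fun η hη => (laplaceIntegrable_congr (hPn η hη) θ).2
      ((hP η hη).laplaceIntegrable n₀ n hθ), ?_⟩
    have hjump : Tendsto (fun η => laplaceTransform (fun t => P η t (m + 1) n) θ -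
        laplaceTransform (fun t => P η t m n) θ) atTop (𝓝 0) := by
      refine squeeze_zero_norm' (a := fun η => (‖θ‖ + 2 * ρ) / θ.re / η) ?_
        (tendsto_const_nhds.div_atTop tendsto_id)
      filter_upwards [eventually_gt_atTop 0] with η hη
      exact (hP η hη).norm_laplaceTransform_succ_sub_le hρ hη hn hθ
    -- The right side of `eq_green_add`: only the jump depends on `η`.
    have hlim := (hjump.mul_const ((ρ : ℂ) ^ (m + 1) / m.factorial /
      (((m : ℂ) + 1) * F r ρ (m + 1) θ - ρ * F r ρ m θ) *
        (n₀.factorial / (ρ : ℂ) ^ n₀ * F r ρ n₀ θ))).const_add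
      (green ρ (Complex.Gamma θ * Complex.exp (-(ρ : ℂ)) / (ρ : ℂ) ^ θ) (fun n => F r ρ n θ)
        (fun n => G ε R ρ n θ + omega r ε R ρ m θ * F r ρ n θ) n₀ n)
    rw [zero_mul, add_zero] at hlim
    refine hlim.congr' ?_
    filter_upwards [eventually_gt_atTop 0] with η hη
    rw [laplaceTransform_congr (hPn η hη)]
    exact (hpair.eq_green_add hbdry hn hD (u := fun i => laplaceTransform (fun t => P η t i n) θ)
      (fun i hi => (hP η hη).laplaceTransform_erlangA_eq hi n hθ) hn₀).symm
  · intro Ω _ μ _ N hN i₀ hi₀ hi₀' n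
    obtain ⟨P, hP, hPN⟩ := hN.transientProb_eq
    have hPn := hPN i₀ hi₀' n
    refine ⟨(laplaceIntegrable_congr hPn θ).2 (hP.laplaceIntegrable i₀ n hθ), ?_⟩
    rw [laplaceTransform_congr hPn]
    have h := hpair.eq_green_add hbdry (Nat.lt_succ_iff.1 n.2) hD
      (u := fun i => laplaceTransform (fun t => P t (Fin.ofNat (m + 1) (min i m)) n) θ)
      (fun i hi => hP.laplaceTransform_erlangLoss_eq hi n hθ) (Nat.lt_succ_iff.1 i₀.2)
    have hcast : Fin.ofNat (m + 1) (min (i₀ : ℕ) m) = i₀ := by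
      rw [min_eq_left (Nat.lt_succ_iff.1 i₀.2)]
      exact Fin.ofNat_val_eq_self i₀
    -- The extended transforms agree at `m` and `m + 1`, so the jump term is exactly zero.
    simp only [hcast, min_eq_right (Nat.le_succ m), min_self, sub_self, zero_mul, add_zero] at h
    rw [h, hi₀]
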